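/- Let $d\ge 3$, $d-3<s<d-1$, and let $\mathbb D=\{x\in\mathbb R^d : x_1=0,\ x_2^2+\dots+x_d^2\le 1\}$. For a compact set $E\subset\mathbb D$ let $\mathcal M(E)$ be the set of Borel probability measures supported on $E$. For a measure $\mu$ put $I_s(\mu)=\iint |x-y|^{-s}\,d\mu(x)\,d\mu(y)\in[0,\infty]$, and put $W_s(E)=\inf\{I_s(\mu):\mu\in\mathcal M(E)\}$ and $\operatorname{cap}_s(E)=1/W_s(E)$. If $\operatorname{cap}_s(E)>0$, let $\mu_E$ be the equilibrium measure of $E$, i.e. the unique $\mu_E\in\mathcal M(E)$ with $I_s(\mu_E)=W_s(E)$. Let $Q:\mathbb D\to[0,\infty]$ be an external field, i.e. a lower semicontinuous function that is finite on a set of positive surface area measure, that is, $(d-1)$-dimensional Lebesgue measure on the hyperplane $x_1=0$. Put $I_Q(\mu)=I_s(\mu)+2\int Q\,d\mu$ and $V_Q=\inf\{I_Q(\mu):\mu\in\mathcal M(\mathbb D)\}$. For every compact $E\subset\mathbb D$ with $\operatorname{cap}_s(E)>0$ define $$\mathcal F_s(E)=W_s(E)+\int Q\,d\mu_E\in[0,\infty].$$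 Then $V_Q<\infty$ and there is an extremal measure, i.e. a measure $\mu_Q\in\mathcal M(\mathbb D)$ with $I_Q(\mu_Q)=V_Q$. For every such $\mu_Q$, the set $S_Q=\operatorname{supp}\mu_Q$ is a compact subset of $\mathbb D$ with $\operatorname{cap}_s(S_Q)>0$, $$\mathcal F_s(S_Q)=F_Q:=V_Q-\int Q\,d\mu_Q,$$ and $\mathcal F_s(S_Q)\le\mathcal F_s(E)$ for every compact $E\subset\mathbb D$ with $\operatorname{cap}_s(E)>0$. -/

import Mathlib

open MeasureTheory Set
open scoped ENNReal

noncomputable section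

namespace RieszDisk

/-- The flat unit disk of `ℝ^d`: the points with first coordinate (index `0`) equal to `0` and
Euclidean norm at most `1`. -/
def disk (d : ℕ) : Set (EuclideanSpace ℝ (Fin d)) :=
  {x | (∀ i : Fin d, (i : ℕ) = 0 → x i = 0) ∧ ‖x‖ ≤ 1}

/-- The class `𝓜(E)` of Borel probability measures on `ℝ^d` supported on `E`. -/
def unitMeasures {d : ℕ} (E : Set (EuclideanSpace ℝ (Fin d))) :
    Set (Measure (EuclideanSpace ℝ (Fin d))) :=
  {μ | IsProbabilityMeasure μ ∧ μ Eᶜ = 0}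

/-- The Riesz `s`-potential `U_s^μ(x) = ∫ |x - y|^{-s} dμ(y)`, with values in `[0, ∞]`
(for `s > 0` the integrand is `∞` at `y = x`). -/
def rieszPotential {d : ℕ} (s : ℝ) (μ : Measure (EuclideanSpace ℝ (Fin d)))
    (x : EuclideanSpace ℝ (Fin d)) : ℝ≥0∞ :=
  ∫⁻ y, 1 / edist x y ^ s ∂μ

/-- The Riesz `s`-energy `I_s(μ) = ∬ |x - y|^{-s} dμ(y) dμ(x)`. -/
def rieszEnergy {d : ℕ} (s : ℝ) (μ : Measure (EuclideanSpace ℝ (Fin d))) : ℝ≥0∞ :=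
  ∫⁻ x, rieszPotential s μ x ∂μ

/-- `W_s(E) = inf {I_s(μ) : μ ∈ 𝓜(E)}`. -/
def minEnergy {d : ℕ} (s : ℝ) (E : Set (EuclideanSpace ℝ (Fin d))) : ℝ≥0∞ :=
  ⨅ μ ∈ unitMeasures E, rieszEnergy s μ

/-- The Riesz `s`-capacity `cap_s(E) = 1 / W_s(E)`. -/
def capacity {d : ℕ} (s : ℝ) (E : Set (EuclideanSpace ℝ (Fin d))) : ℝ≥0∞ :=
  1 / minEnergy s E

/-- `μ` is a Riesz `s`-equilibrium measure of `E` (no external field). -/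
def IsEquilibriumMeasure {d : ℕ} (s : ℝ) (E : Set (EuclideanSpace ℝ (Fin d)))
    (μ : Measure (EuclideanSpace ℝ (Fin d))) : Prop :=
  μ ∈ unitMeasures E ∧ rieszEnergy s μ = minEnergy s E

open Classical in
/-- The Riesz `s`-equilibrium measure `μ_E`. It exists and is unique for compact `E` of positive
capacity and `0 < s < d`; where there is none, the value is `0`. -/
def equilibriumMeasure {d : ℕ} (s : ℝ) (E : Set (EuclideanSpace ℝ (Fin d))) :
    Measure (EuclideanSpace ℝ (Fin d)) :=
  if h : ∃ μ, IsEquilibriumMeasure s E μ then h.choose else 0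

/-- `Q` is an external field on the disk: lower semicontinuous there with values in `[0, ∞]`, and
finite on a subset of the disk of positive surface area, i.e. of positive (Euclidean, so equal to
Lebesgue measure on the hyperplane) `(d-1)`-dimensional Hausdorff measure. The values of `Q` off the disk play no role. -/
structure IsExternalField (d : ℕ) (Q : EuclideanSpace ℝ (Fin d) → ℝ≥0∞) : Prop where
  lowerSemicontinuousOn : LowerSemicontinuousOn Q (disk d)
  finite_on_pos : 0 < μHE[d - 1] {x | x ∈ disk d ∧ Q x < ∞}

/-- The weighted energy `I_Q(μ) = I_s(μ) + 2 ∫ Q dμ`. -/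
def weightedEnergy {d : ℕ} (s : ℝ) (Q : EuclideanSpace ℝ (Fin d) → ℝ≥0∞)
    (μ : Measure (EuclideanSpace ℝ (Fin d))) : ℝ≥0∞ :=
  rieszEnergy s μ + 2 * ∫⁻ x, Q x ∂μ

/-- `V_Q = inf {I_Q(μ) : μ ∈ 𝓜(D)}`, where `D` is the unit disk. -/
def minWeightedEnergy {d : ℕ} (s : ℝ) (Q : EuclideanSpace ℝ (Fin d) → ℝ≥0∞) : ℝ≥0∞ :=
  ⨅ μ ∈ unitMeasures (disk d), weightedEnergy s Q μ

/-- `μ` is an `s`-extremal measure on the disk associated with `Q`. -/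
def IsExtremalMeasure {d : ℕ} (s : ℝ) (Q : EuclideanSpace ℝ (Fin d) → ℝ≥0∞)
    (μ : Measure (EuclideanSpace ℝ (Fin d))) : Prop :=
  μ ∈ unitMeasures (disk d) ∧ weightedEnergy s Q μ = minWeightedEnergy s Q

/-- The constant `F_Q = V_Q - ∫ Q dμ_Q`, as a function of the extremal measure `μ_Q`. The
subtraction in `[0, ∞]` is the usual one as soon as `V_Q < ∞`, since `∫ Q dμ_Q ≤ V_Q`. -/
def extremalConstant {d : ℕ} (s : ℝ) (Q : EuclideanSpace ℝ (Fin d) → ℝ≥0∞)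
    (μQ : Measure (EuclideanSpace ℝ (Fin d))) : ℝ≥0∞ :=
  minWeightedEnergy s Q - ∫⁻ x, Q x ∂μQ

/-- The Mhaskar–Saff functional `𝓕_s(E) = W_s(E) + ∫ Q dμ_E`, with values in `[0, ∞]`. -/
def mhaskarSaff {d : ℕ} (s : ℝ) (Q : EuclideanSpace ℝ (Fin d) → ℝ≥0∞)
    (E : Set (EuclideanSpace ℝ (Fin d))) : ℝ≥0∞ :=
  minEnergy s E + ∫⁻ x, Q x ∂(equilibriumMeasure s E)

end RieszDisk

end

noncomputable section

namespace RieszDisk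

/-! Write U^μ for the potential of μ, and let μ be extremal, so that F_Q = I_s(μ) + ∫ Q dμ. Moving a
little mass from μ to a measure ν of finite energy gives, to first order, F_Q ≤ ∫ U^μ dν + ∫ Q dν
(`add_le_of_forall_weightedEnergy_le`). Testing with pieces of μ itself yields U^μ + Q ≤ F_Q on supp
μ (`frostman`).

Lower bound: with ν = μ_E and the symmetry of the mutual energy, F_Q ≤ ∫ U^{μ_E} dμ + ∫ Q dμ_E.
Since U^{μ_E} ≤ W_s(E) on the whole disk, this is at most 𝓕_s(E). Equality at E = supp μ: the
variational inequality for μ_E, tested with μ, gives W_s(E) ≤ ∫ U^μ dμ_E, so 𝓕_s(E) ≤ ∫ (U^μ + Q)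
dμ_E ≤ F_Q by `frostman`.

The bound on U^{μ_E} off E is the maximum principle `rieszPotential_le_of_le_on_support`. In the
hyperplane, of dimension d - 1, the Laplacian of |w|^{-s} is s(s + 3 - d)|w|^{-s-2} > 0, so a
potential has no maximum off the support. Egorov's theorem reduces to upper semicontinuous
potentials, whose maximum is attained. Minimisers exist by weak compactness and lower
semicontinuity; V_Q is finite because surface measure has finite energy for s < d - 1. -/

open Filter Topology

/-! ### Weak lower semicontinuity and existence of minimisers -/

/-- Integration of a lower semicontinuous function is lower semicontinuous for the weak topology
on probability measures. -/
theorem lowerSemicontinuous_lintegral {X : Type*} [TopologicalSpace X] [MeasurableSpace X]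
    [BorelSpace X] [HasOuterApproxClosed X] [FirstCountableTopology (ProbabilityMeasure X)]
    {f : X → ℝ≥0∞} (hf : LowerSemicontinuous f) :
    LowerSemicontinuous fun μ : ProbabilityMeasure X => ∫⁻ x, f x ∂(μ : Measure X) := by
  have trunc : ∀ N : ℕ, LowerSemicontinuous
      fun μ : ProbabilityMeasure X => ∫⁻ x, min (f x) N ∂(μ : Measure X) := by
    intro N μ y hy
    by_contra hcon
    obtain ⟨μs, hμs, hle⟩ := exists_seq_forall_of_frequently (not_eventually.mp hcon)
    set g : X → ℝ := fun x => (min (f x) N).toReal with hg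
    have hne : ∀ x, min (f x) N ≠ ∞ := fun x =>
      ((min_le_right _ _).trans_lt (ENNReal.natCast_lt_top N)).ne
    have hfg : ∀ x, min (f x) N = ENNReal.ofReal (g x) := fun x => (ENNReal.ofReal_toReal (hne x)).symm
    have hopen : ∀ t : ℝ, 0 ≤ t → IsOpen {a | t < g a} := by
      intro t ht
      have : {a | t < g a} = {a | ENNReal.ofReal t < f a} ∩ {_a | ENNReal.ofReal t < N} := by
        ext a
        simp only [mem_ofPred_eq, mem_inter_iff, hg]
        rw [← ENNReal.ofReal_lt_iff_lt_toReal ht (hne a), lt_min_iff]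
      rw [this]
      exact (hf.isOpen_preimage _).inter isOpen_const
    have hmeas : Measurable g := (hf.measurable.min measurable_const).ennreal_toReal
    -- The layer cake formula reduces the claim to the open superlevel sets, where the portmanteau
    -- theorem and Fatou's lemma apply.
    have cake : ∀ ρ : Measure X, ∫⁻ x, min (f x) N ∂ρ = ∫⁻ t in Ioi (0 : ℝ), ρ {a | t < g a} := by
      intro ρ
      simp_rw [hfg]
      exact lintegral_eq_lintegral_meas_lt ρ (Eventually.of_forall fun x => ENNReal.toReal_nonneg)
        hmeas.aemeasurable
    have hy' : y < ∫⁻ x, min (f x) N ∂(μ : Measure X) := hy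
    refine absurd hy' (not_lt.mpr ?_)
    calc ∫⁻ x, min (f x) N ∂(μ : Measure X)
        = ∫⁻ t in Ioi (0 : ℝ), (μ : Measure X) {a | t < g a} := cake _
      _ ≤ ∫⁻ t in Ioi (0 : ℝ), liminf (fun n => (μs n : Measure X) {a | t < g a}) atTop := by
          refine setLIntegral_mono_ae' measurableSet_Ioi (Eventually.of_forall fun t ht => ?_)
          exact ProbabilityMeasure.le_liminf_measure_open_of_tendsto hμs (hopen t (le_of_lt ht))
      _ ≤ liminf (fun n => ∫⁻ t in Ioi (0 : ℝ), (μs n : Measure X) {a | t < g a}) atTop :=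
          lintegral_liminf_le fun n => Antitone.measurable fun a b hab =>
            measure_mono fun x hx => lt_of_le_of_lt hab hx
      _ = liminf (fun n => ∫⁻ x, min (f x) N ∂(μs n : Measure X)) atTop := by simp_rw [cake]
      _ ≤ y := by
          refine liminf_le_of_frequently_le' (Frequently.of_forall fun n => not_lt.mp (hle n))
  have hsup : (fun μ : ProbabilityMeasure X => ∫⁻ x, f x ∂(μ : Measure X)) =
      fun μ : ProbabilityMeasure X => ⨆ N : ℕ, ∫⁻ x, min (f x) N ∂(μ : Measure X) := by
    funext μ
    rw [← lintegral_iSup]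
    · refine lintegral_congr fun x => ?_
      rw [← inf_iSup_eq, ENNReal.iSup_natCast, inf_top_eq]
    · exact fun N => hf.measurable.min measurable_const
    · exact fun N M h x => min_le_min le_rfl (by exact_mod_cast h)
  rw [hsup]
  exact lowerSemicontinuous_iSup trunc

theorem continuous_kernel {X : Type*} [PseudoEMetricSpace X] (s : ℝ) :
    Continuous fun p : X × X => 1 / edist p.1 p.2 ^ s := by
  simp_rw [one_div]
  exact (ENNReal.continuous_rpow_const.comp continuous_edist).inv

variable {d : ℕ} {s : ℝ}

theorem measurable_kernel : Measurable
    fun p : EuclideanSpace ℝ (Fin d) × EuclideanSpace ℝ (Fin d) => 1 / edist p.1 p.2 ^ s :=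
  (continuous_kernel s).measurable

theorem measurable_kernel_right (x : EuclideanSpace ℝ (Fin d)) :
    Measurable fun y => 1 / edist x y ^ s :=
  ((continuous_kernel s).comp (Continuous.prodMk_right x)).measurable

theorem rieszEnergy_map {X : Type*} [MeasurableSpace X] {ρ : Measure X}
    {f : X → EuclideanSpace ℝ (Fin d)} (hf : MeasurableEmbedding f) :
    rieszEnergy s (ρ.map f) = ∫⁻ x, ∫⁻ y, 1 / edist (f x) (f y) ^ s ∂ρ ∂ρ := by
  simp_rw [rieszEnergy, rieszPotential, hf.lintegral_map]

/-- Passing to measures on the subtype makes the weak compactness of `ProbabilityMeasure K`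
available. -/
theorem exists_map_eq {K : Set (EuclideanSpace ℝ (Fin d))} (hK : MeasurableSet K)
    {μ : Measure (EuclideanSpace ℝ (Fin d))} (hμ : μ ∈ unitMeasures K) :
    ∃ ρ : ProbabilityMeasure K, (ρ : Measure K).map Subtype.val = μ := by
  have := hμ.1
  have hmap : (μ.comap (Subtype.val : K → _)).map Subtype.val = μ := by
    rw [(MeasurableEmbedding.subtype_coe hK).map_comap, Subtype.range_coe]
    exact Measure.restrict_eq_self_of_ae_mem hμ.2
  refine ⟨⟨μ.comap Subtype.val, ⟨?_⟩⟩, hmap⟩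
  have h1 : (μ.comap (Subtype.val : K → _)).map Subtype.val univ = 1 := by
    rw [hmap, measure_univ]
  rwa [Measure.map_apply measurable_subtype_coe MeasurableSet.univ, preimage_univ] at h1

theorem map_mem_unitMeasures {K : Set (EuclideanSpace ℝ (Fin d))} (hK : MeasurableSet K)
    (ρ : ProbabilityMeasure K) : (ρ : Measure K).map Subtype.val ∈ unitMeasures K := by
  refine ⟨Measure.isProbabilityMeasure_map measurable_subtype_coe.aemeasurable, ?_⟩
  rw [Measure.map_apply measurable_subtype_coe hK.compl]
  simp

/-- The weighted energy attains its minimum over the unit measures on a compact set. -/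
theorem exists_forall_weightedEnergy_le {K : Set (EuclideanSpace ℝ (Fin d))} (hK : IsCompact K)
    {Q : EuclideanSpace ℝ (Fin d) → ℝ≥0∞} (hQ : LowerSemicontinuous Q)
    (hne : (unitMeasures K).Nonempty) :
    ∃ μ ∈ unitMeasures K, ∀ ν ∈ unitMeasures K, weightedEnergy s Q μ ≤ weightedEnergy s Q ν := by
  have hKm := hK.measurableSet
  have : CompactSpace K := isCompact_iff_compactSpace.mp hK
  have hemb := MeasurableEmbedding.subtype_coe hKm
  have hform : ∀ ρ : ProbabilityMeasure K, weightedEnergy s Q ((ρ : Measure K).map Subtype.val) =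
      ∫⁻ p, 1 / edist p.1 p.2 ^ s ∂((ρ.prod ρ : ProbabilityMeasure (K × K)) : Measure (K × K)) +
        ∫⁻ x : K, 2 * Q x ∂(ρ : Measure K) := by
    intro ρ
    rw [weightedEnergy, rieszEnergy_map hemb, hemb.lintegral_map, ProbabilityMeasure.toMeasure_prod,
      lintegral_prod _ (continuous_kernel s).measurable.aemeasurable,
      lintegral_const_mul' _ _ (by simp)]
    rfl
  have hQ2 : LowerSemicontinuous fun x : K => 2 * Q x := by
    simp_rw [two_mul]
    have : LowerSemicontinuous fun x : K => Q x := hQ.comp continuous_subtype_val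
    exact this.add this
  have hlsc : LowerSemicontinuous fun ρ : ProbabilityMeasure K =>
      weightedEnergy s Q ((ρ : Measure K).map Subtype.val) := by
    simp_rw [hform]
    refine LowerSemicontinuous.add ?_ (lowerSemicontinuous_lintegral hQ2)
    -- The energy is a linear functional of ρ ⊗ ρ, which depends continuously on ρ.
    exact (lowerSemicontinuous_lintegral (X := K × K)
      (continuous_kernel s).lowerSemicontinuous).comp
      (g := fun ρ : ProbabilityMeasure K => ρ.prod ρ)
      (ProbabilityMeasure.continuous_prod.comp (continuous_id.prodMk continuous_id))
  obtain ⟨μ₀, hμ₀⟩ := hne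
  obtain ⟨ρ₀, -⟩ := exists_map_eq hKm hμ₀
  obtain ⟨ρ, -, hρ⟩ := (hlsc.lowerSemicontinuousOn univ).exists_isMinOn ⟨ρ₀, mem_univ _⟩ isCompact_univ
  refine ⟨_, map_mem_unitMeasures hKm ρ, fun ν hν => ?_⟩
  obtain ⟨σ, rfl⟩ := exists_map_eq hKm hν
  exact hρ (mem_univ σ)

/-! ### Potentials and mutual energies -/

theorem measurable_rieszPotential (μ : Measure (EuclideanSpace ℝ (Fin d))) [SFinite μ] :
    Measurable (rieszPotential s μ) :=
  Measurable.lintegral_prod_right' measurable_kernel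

theorem lowerSemicontinuous_rieszPotential (μ : Measure (EuclideanSpace ℝ (Fin d))) :
    LowerSemicontinuous (rieszPotential s μ) := by
  intro x y hy
  by_contra hcon
  obtain ⟨xs, hxs, hle⟩ := exists_seq_forall_of_frequently (not_eventually.mp hcon)
  refine absurd hy (not_lt.mpr ?_)
  calc rieszPotential s μ x
      = ∫⁻ z, liminf (fun n => 1 / edist (xs n) z ^ s) atTop ∂μ := by
        refine lintegral_congr fun z => ?_
        have : Tendsto (fun n => 1 / edist (xs n) z ^ s) atTop (𝓝 (1 / edist x z ^ s)) :=
          (((continuous_kernel s).comp (Continuous.prodMk_left z)).tendsto x).comp hxs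
        exact this.liminf_eq.symm
    _ ≤ liminf (fun n => rieszPotential s μ (xs n)) atTop :=
        lintegral_liminf_le fun n => measurable_kernel_right _
    _ ≤ y := liminf_le_of_frequently_le' (Frequently.of_forall fun n => not_lt.mp (hle n))

theorem lintegral_rieszPotential_comm (μ ν : Measure (EuclideanSpace ℝ (Fin d)))
    [SFinite μ] [SFinite ν] :
    ∫⁻ x, rieszPotential s μ x ∂ν = ∫⁻ x, rieszPotential s ν x ∂μ := by
  simp_rw [rieszPotential]
  rw [lintegral_lintegral_swap measurable_kernel.aemeasurable]
  simp_rw [edist_comm]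

theorem rieszPotential_add (μ ν : Measure (EuclideanSpace ℝ (Fin d)))
    (x : EuclideanSpace ℝ (Fin d)) :
    rieszPotential s (μ + ν) x = rieszPotential s μ x + rieszPotential s ν x :=
  lintegral_add_measure _ _ _

theorem rieszPotential_smul (c : ℝ≥0∞) (μ : Measure (EuclideanSpace ℝ (Fin d)))
    (x : EuclideanSpace ℝ (Fin d)) :
    rieszPotential s (c • μ) x = c * rieszPotential s μ x :=
  lintegral_smul_measure _ _

theorem rieszEnergy_smul_add_smul (a b : ℝ≥0∞) (μ ν : Measure (EuclideanSpace ℝ (Fin d)))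
    [SFinite μ] [SFinite ν] :
    rieszEnergy s (a • μ + b • ν) = a * (a * rieszEnergy s μ + b * ∫⁻ x, rieszPotential s μ x ∂ν)
      + b * (a * (∫⁻ x, rieszPotential s μ x ∂ν) + b * rieszEnergy s ν) := by
  have h := measurable_rieszPotential (s := s) μ
  have h' := measurable_rieszPotential (s := s) ν
  simp_rw [rieszEnergy, rieszPotential_add, rieszPotential_smul, lintegral_add_measure,
    lintegral_smul_measure]
  rw [lintegral_add_left (h.const_mul a), lintegral_add_left (h.const_mul a),
    lintegral_const_mul _ h, lintegral_const_mul _ h', lintegral_const_mul _ h,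
    lintegral_const_mul _ h', lintegral_rieszPotential_comm ν μ]
  rfl

/-! ### The variational inequality and Frostman's theorem -/

/-- The right side minus the left is 2t(J + r - I - q) + t²(I - 2J + L), so the linear coefficient
cannot be negative. -/
theorem le_of_quadratic_perturbation {I J L q r : ℝ}
    (h : ∀ t, 0 ≤ t → t ≤ 1 → I + 2 * q ≤
      (1 - t) * ((1 - t) * I + t * J) + t * ((1 - t) * J + t * L) + 2 * ((1 - t) * q + t * r)) :
    I + q ≤ J + r := by
  by_contra hlt
  push Not at hlt
  set D := I + q - J - r with hD
  have hDpos : 0 < D := by linarith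
  set C := |I - 2 * J + L| with hC
  have hC0 : 0 ≤ C := abs_nonneg _
  -- So small that the quadratic term, at most t²C, stays below tD and cannot offset the linear gain
  -- 2tD.
  set t := min 1 (D / (C + 1)) with ht
  have ht0 : 0 < t := lt_min one_pos (by positivity)
  have h1 := h t ht0.le (min_le_left _ _)
  have h2 : t * (2 * D) ≤ t * (t * (I - 2 * J + L)) := by rw [hD]; nlinarith
  have h3 : 2 * D ≤ t * (I - 2 * J + L) := le_of_mul_le_mul_left h2 ht0
  have h4 : t * (I - 2 * J + L) ≤ t * C := by gcongr; exact le_abs_self _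
  have h5 : t * (C + 1) ≤ D := by
    calc t * (C + 1) ≤ D / (C + 1) * (C + 1) := by gcongr; exact min_le_right _ _
      _ = D := by field_simp
  nlinarith

/-- The variational inequality for a minimiser of the weighted energy. -/
theorem add_le_of_forall_weightedEnergy_le {K : Set (EuclideanSpace ℝ (Fin d))}
    {Q : EuclideanSpace ℝ (Fin d) → ℝ≥0∞} {μ ν : Measure (EuclideanSpace ℝ (Fin d))}
    (hμ : μ ∈ unitMeasures K) (hfin : weightedEnergy s Q μ < ∞)
    (hmin : ∀ ρ ∈ unitMeasures K, weightedEnergy s Q μ ≤ weightedEnergy s Q ρ)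
    (hν : ν ∈ unitMeasures K) (hνfin : rieszEnergy s ν < ∞) :
    rieszEnergy s μ + ∫⁻ x, Q x ∂μ ≤ (∫⁻ x, rieszPotential s μ x ∂ν) + ∫⁻ x, Q x ∂ν := by
  have := hμ.1
  have := hν.1
  by_cases hJ : ∫⁻ x, rieszPotential s μ x ∂ν = ∞
  · simp [hJ]
  by_cases hr : ∫⁻ x, Q x ∂ν = ∞
  · simp [hr]
  rw [weightedEnergy, ENNReal.add_lt_top] at hfin
  have hI := hfin.1.ne
  have hq : ∫⁻ x, Q x ∂μ ≠ ∞ := by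
    intro h; rw [h] at hfin; simp at hfin
  have key : ∀ t : ℝ, 0 ≤ t → t ≤ 1 → weightedEnergy s Q μ ≤
      weightedEnergy s Q (ENNReal.ofReal (1 - t) • μ + ENNReal.ofReal t • ν) := by
    intro t h0 h1
    refine hmin _ ⟨⟨?_⟩, ?_⟩
    · simp only [Measure.coe_add, Measure.coe_smul, Pi.add_apply, Pi.smul_apply, measure_univ,
        smul_eq_mul, mul_one]
      rw [← ENNReal.ofReal_add (by linarith) h0]
      simp
    · simp [hμ.2, hν.2]
  simp only [weightedEnergy, rieszEnergy_smul_add_smul, lintegral_add_measure,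
    lintegral_smul_measure, smul_eq_mul] at key
  lift rieszEnergy s μ to NNReal using hI with I
  lift rieszEnergy s ν to NNReal using hνfin.ne with L
  lift ∫⁻ x, rieszPotential s μ x ∂ν to NNReal using hJ with J
  lift ∫⁻ x, Q x ∂μ to NNReal using hq with q
  lift ∫⁻ x, Q x ∂ν to NNReal using hr with r
  norm_cast
  rw [← NNReal.coe_le_coe]
  push_cast
  refine le_of_quadratic_perturbation (L := L) fun t h0 h1 => ?_
  have := key t h0 h1
  lift t to NNReal using h0
  obtain ⟨u, hu⟩ : ∃ u : NNReal, (u : ℝ) = 1 - t := ⟨⟨1 - t, by linarith⟩, rfl⟩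
  rw [← hu] at this ⊢
  simp only [ENNReal.ofReal_coe_nnreal] at this
  exact_mod_cast this

/-- Frostman's theorem for a minimiser of the weighted energy. -/
theorem frostman {K : Set (EuclideanSpace ℝ (Fin d))}
    {Q : EuclideanSpace ℝ (Fin d) → ℝ≥0∞} (hQ : LowerSemicontinuous Q)
    {μ : Measure (EuclideanSpace ℝ (Fin d))}
    (hμ : μ ∈ unitMeasures K) (hfin : weightedEnergy s Q μ < ∞)
    (hmin : ∀ ρ ∈ unitMeasures K, weightedEnergy s Q μ ≤ weightedEnergy s Q ρ) :
    ∀ x ∈ μ.support, rieszPotential s μ x + Q x ≤ rieszEnergy s μ + ∫⁻ x, Q x ∂μ := by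
  have := hμ.1
  have hU := measurable_rieszPotential (s := s) μ
  have hfin' := hfin
  rw [weightedEnergy, ENNReal.add_lt_top] at hfin'
  have hq : ∫⁻ x, Q x ∂μ ≠ ∞ := by
    intro h; rw [h] at hfin'; simp at hfin'
  set F := rieszEnergy s μ + ∫⁻ x, Q x ∂μ with hF
  have hFtop : F ≠ ∞ := ENNReal.add_ne_top.mpr ⟨hfin'.1.ne, hq⟩
  have hint : ∫⁻ x, rieszPotential s μ x + Q x ∂μ = F := lintegral_add_left hU _
  have hlsc : LowerSemicontinuous fun x => rieszPotential s μ x + Q x :=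
    (lowerSemicontinuous_rieszPotential μ).add hQ
  set A := {x | rieszPotential s μ x + Q x < F} with hA
  have hAm : MeasurableSet A := measurableSet_lt hlsc.measurable measurable_const
  have hAzero : μ A = 0 := by
    -- Otherwise the normalised restriction of μ to `A` is a test measure whose average of U^μ + Q
    -- is below `F`.
    by_contra hne
    set c := (μ A)⁻¹ with hc
    have hctop : c ≠ ∞ := ENNReal.inv_ne_top.mpr hne
    have hc0 : c ≠ 0 := ENNReal.inv_ne_zero.mpr (measure_ne_top μ A)
    have hν : c • μ.restrict A ∈ unitMeasures K := by
      refine ⟨⟨?_⟩, ?_⟩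
      · simp [hc, ENNReal.inv_mul_cancel hne (measure_ne_top μ A)]
      · have : μ.restrict A Kᶜ = 0 := le_antisymm ((Measure.restrict_le_self _).trans hμ.2.le) zero_le
        simp [this]
    have hνfin : rieszEnergy s (c • μ.restrict A) < ∞ := by
      have h1 : rieszEnergy s (μ.restrict A) ≤ rieszEnergy s μ :=
        lintegral_mono' Measure.restrict_le_self fun x =>
          lintegral_mono' Measure.restrict_le_self fun y => le_rfl
      have h2 : rieszEnergy s (c • μ.restrict A) = c * (c * rieszEnergy s (μ.restrict A)) := by
        simp only [rieszEnergy, rieszPotential_smul, lintegral_smul_measure, smul_eq_mul]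
        rw [lintegral_const_mul' _ _ hctop]
      rw [h2]
      exact ENNReal.mul_lt_top hctop.lt_top
        (ENNReal.mul_lt_top hctop.lt_top (h1.trans_lt hfin'.1))
    have h := add_le_of_forall_weightedEnergy_le hμ hfin hmin hν hνfin
    rw [← hF, ← lintegral_add_left hU, lintegral_smul_measure, smul_eq_mul] at h
    have hlt : ∫⁻ x in A, rieszPotential s μ x + Q x ∂μ < ∫⁻ x in A, F ∂μ := by
      refine lintegral_strict_mono (by simpa using hne) aemeasurable_const ?_ ?_
      · exact ((setLIntegral_le_lintegral _ _).trans_lt (hint ▸ hFtop.lt_top)).ne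
      · exact (ae_restrict_iff' hAm).mpr (Eventually.of_forall fun x hx => hx)
    rw [setLIntegral_const] at hlt
    have h3 : c * ∫⁻ x in A, rieszPotential s μ x + Q x ∂μ < c * (F * μ A) :=
      (ENNReal.mul_lt_mul_iff_right hc0 hctop).mpr hlt
    rw [mul_comm F, ← mul_assoc, hc, ENNReal.inv_mul_cancel hne (measure_ne_top μ A), one_mul] at h3
    exact absurd h (not_le.mpr h3)
  have hge : ∀ᵐ x ∂μ, F ≤ rieszPotential s μ x + Q x := by
    rw [ae_iff]; simpa [hA] using hAzero
  -- The μ-average of U^μ + Q is exactly `F`, so the lower bound is an equality almost everywhere.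
  have heq : (fun _ => F) =ᵐ[μ] fun x => rieszPotential s μ x + Q x :=
    ae_eq_of_ae_le_of_lintegral_le hge (by simpa using hFtop) hlsc.measurable.aemeasurable
      (by rw [hint]; simp)
  intro x hx
  by_contra hlt
  push Not at hlt
  -- Lower semicontinuity turns the almost everywhere bound into one at every point of the support:
  -- an open null set misses it.
  have hopen : IsOpen {x | F < rieszPotential s μ x + Q x} := hlsc.isOpen_preimage F
  have hpos := (Measure.mem_support_iff_forall x).mp hx _ (hopen.mem_nhds hlt)
  refine hpos.ne' ?_
  have : ∀ᵐ x ∂μ, ¬ F < rieszPotential s μ x + Q x := by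
    filter_upwards [heq] with x hx
    exact not_lt.mpr hx.ge
  simpa [ae_iff] using this

/-! ### Strict subharmonicity of the kernel along the hyperplane -/

/-- The product of the two terms is (1 - x²)^{-m} ≥ 1; apply the arithmetic-geometric mean
inequality. -/
theorem two_le_rpow_add_rpow_neg {m x : ℝ} (hm : 0 < m) (h0 : 0 ≤ x) (h1 : x < 1) :
    2 ≤ (1 + x) ^ (-m) + (1 - x) ^ (-m) := by
  have ha : 0 < 1 + x := by linarith
  have hb : 0 < 1 - x := by linarith
  have h : 1 ≤ (1 + x) ^ (-m) * (1 - x) ^ (-m) := by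
    rw [← Real.mul_rpow ha.le hb.le]
    exact Real.one_le_rpow_of_pos_of_le_one_of_nonpos (by positivity) (by nlinarith) (by linarith)
  have := Real.rpow_pos_of_pos ha (-m)
  have := Real.rpow_pos_of_pos hb (-m)
  nlinarith [sq_nonneg ((1 + x) ^ (-m) - (1 - x) ^ (-m))]

theorem hasDerivAt_one_add_rpow_neg (m : ℝ) {x : ℝ} (h : -1 < x) :
    HasDerivAt (fun x : ℝ => (1 + x) ^ (-m)) (-m * (1 + x) ^ (-(m + 1))) x := by
  have h1 : HasDerivAt (fun x : ℝ => 1 + x) 1 x := (hasDerivAt_id x).const_add 1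
  convert h1.rpow_const (p := -m) (Or.inl (by linarith)) using 1
  rw [show -(m + 1) = -m - 1 by ring]; ring

theorem hasDerivAt_one_sub_rpow_neg (m : ℝ) {x : ℝ} (h : x < 1) :
    HasDerivAt (fun x : ℝ => (1 - x) ^ (-m)) (m * (1 - x) ^ (-(m + 1))) x := by
  have h1 : HasDerivAt (fun x : ℝ => 1 - x) (-1) x := (hasDerivAt_id x).const_sub 1
  convert h1.rpow_const (p := -m) (Or.inl (by linarith)) using 1
  rw [show -(m + 1) = -m - 1 by ring]; ring

theorem two_mul_le_rpow_sub_rpow_neg {m x : ℝ} (hm : 0 < m) (h0 : 0 ≤ x) (h1 : x < 1) :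
    2 * m * x ≤ (1 - x) ^ (-m) - (1 + x) ^ (-m) := by
  have hder : ∀ y ∈ Ico (0 : ℝ) 1, HasDerivAt
      (fun y : ℝ => (1 - y) ^ (-m) - (1 + y) ^ (-m) - 2 * m * y)
      (m * (1 - y) ^ (-(m + 1)) - -m * (1 + y) ^ (-(m + 1)) - 2 * m) y := fun y hy => by
    have := ((hasDerivAt_one_sub_rpow_neg m hy.2).sub
      (hasDerivAt_one_add_rpow_neg m (by linarith [hy.1] : -1 < y))).sub
      ((hasDerivAt_id y).const_mul (2 * m))
    exact this.congr_deriv (by ring)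
  have hmono := monotoneOn_of_deriv_nonneg (convex_Ico (0 : ℝ) 1)
    (fun y hy => (hder y hy).continuousAt.continuousWithinAt)
    (fun y hy => (hder y (interior_subset hy)).differentiableAt.differentiableWithinAt)
    (fun y hy => by
      rw [(hder y (interior_subset hy)).deriv]
      have := interior_subset hy
      have := two_le_rpow_add_rpow_neg (by linarith : 0 < m + 1) this.1 this.2
      nlinarith)
  have := hmono ⟨le_rfl, one_pos⟩ ⟨h0, h1⟩ h0
  simp at this
  linarith

/-- The second-order Taylor polynomial at 0 is a lower bound; each of the two preceding inequalities
integrates to the next. -/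
theorem two_add_sq_le_rpow_add_rpow_neg {p x : ℝ} (hp : 0 < p) (h1 : |x| < 1) :
    2 + p * (p + 1) * x ^ 2 ≤ (1 + x) ^ (-p) + (1 - x) ^ (-p) := by
  wlog h0 : 0 ≤ x generalizing x
  · have := this (x := -x) (by simpa using h1) (by linarith)
    rw [neg_sq, ← sub_eq_add_neg, sub_neg_eq_add] at this
    linarith
  rw [abs_of_nonneg h0] at h1
  have hder : ∀ y ∈ Ico (0 : ℝ) 1, HasDerivAt
      (fun y : ℝ => (1 + y) ^ (-p) + (1 - y) ^ (-p) - p * (p + 1) * y ^ 2)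
      (-p * (1 + y) ^ (-(p + 1)) + p * (1 - y) ^ (-(p + 1)) - p * (p + 1) * (2 * y)) y :=
      fun y hy => by
    have := ((hasDerivAt_one_add_rpow_neg p (by linarith [hy.1] : -1 < y)).add
      (hasDerivAt_one_sub_rpow_neg p hy.2)).sub
      ((hasDerivAt_pow 2 y).const_mul (p * (p + 1)))
    exact this.congr_deriv (by norm_num)
  have hmono := monotoneOn_of_deriv_nonneg (convex_Ico (0 : ℝ) 1)
    (fun y hy => (hder y hy).continuousAt.continuousWithinAt)
    (fun y hy => (hder y (interior_subset hy)).differentiableAt.differentiableWithinAt)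
    (fun y hy => by
      rw [(hder y (interior_subset hy)).deriv]
      have := interior_subset hy
      have := two_mul_le_rpow_sub_rpow_neg (by linarith : 0 < p + 1) this.1 this.2
      nlinarith)
  have := hmono ⟨le_rfl, one_pos⟩ ⟨h0, h1⟩ h0
  simp at this
  linarith

/-- At t = 0 the right side equals 2n and has derivative 2p(2p + 2 - n) > 0. With p = s/2 and n = d
- 1 the last factor is s + 3 - d, which is where s > d - 3 enters. -/
theorem exists_forall_lt_rpow_mul {p n : ℝ} (hp : 0 < p) (hn : n < 2 * p + 2) :
    ∃ t₀ > 0, ∀ t, 0 < t → t < t₀ →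
      2 * n < (1 + t) ^ (-p) * (2 * n + 4 * p * (p + 1) * (t / (1 + t) ^ 2)) := by
  set f : ℝ → ℝ := fun t => (1 + t) ^ (-p) * (2 * n + 4 * p * (p + 1) * (t / (1 + t) ^ 2)) with hf
  have hder : HasDerivAt f (2 * p * (2 * p + 2 - n)) 0 := by
    have h1 : HasDerivAt (fun t : ℝ => t / (1 + t) ^ 2) 1 0 := by
      have h2 : HasDerivAt (fun t : ℝ => (1 + t) ^ 2) 2 0 := by
        have := ((hasDerivAt_id (0 : ℝ)).const_add 1).pow 2
        exact this.congr_deriv (by simp)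
      have := (hasDerivAt_id (0 : ℝ)).div h2 (by norm_num)
      exact this.congr_deriv (by simp)
    have := (hasDerivAt_one_add_rpow_neg p (by norm_num : (-1 : ℝ) < 0)).mul
      ((h1.const_mul (4 * p * (p + 1))).const_add (2 * n))
    exact this.congr_deriv (by simp; ring)
  have hpos : 0 < 2 * p * (2 * p + 2 - n) := mul_pos (by linarith) (by linarith)
  have h0 : f 0 = 2 * n := by simp [hf]
  have hev : ∀ᶠ t in 𝓝[≠] (0 : ℝ), 0 < slope f 0 t :=
    (hasDerivAt_iff_tendsto_slope.mp hder).eventually (lt_mem_nhds hpos)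
  obtain ⟨t₀, ht₀, hsub⟩ := Metric.mem_nhdsWithin_iff.mp hev
  refine ⟨t₀, ht₀, fun t h h' => ?_⟩
  have : 0 < slope f 0 t := hsub ⟨by simpa [abs_of_pos h] using h', h.ne'⟩
  rw [slope_def_field, h0, sub_zero] at this
  have := (div_pos_iff_of_pos_right h).mp this
  show 2 * n < f t
  linarith

/-- The hyperplane that contains the disk. -/
def hyperplane (d : ℕ) : Set (EuclideanSpace ℝ (Fin d)) :=
  {x | ∀ i : Fin d, (i : ℕ) = 0 → x i = 0}

/-- The indices of the directions of the hyperplane. -/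
def directions (d : ℕ) : Finset (Fin d) := Finset.univ.filter fun i => (i : ℕ) ≠ 0

theorem card_directions (d : ℕ) : (directions d).card = d - 1 := by
  cases d with
  | zero => simp [directions]
  | succ m =>
    have : directions (m + 1) = Finset.univ.erase 0 := by
      ext i; simp [directions]
    rw [this]; simp

theorem sum_directions_sq {w : EuclideanSpace ℝ (Fin d)} (hw : w ∈ hyperplane d) :
    ∑ i ∈ directions d, w i ^ 2 = ‖w‖ ^ 2 := by
  rw [EuclideanSpace.real_norm_sq_eq]
  refine Finset.sum_subset (Finset.subset_univ _) fun i _ hi => ?_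
  have : (i : ℕ) = 0 := by simpa [directions] using hi
  simp [hw i this]

theorem norm_add_single_sq (w : EuclideanSpace ℝ (Fin d)) (i : Fin d) (h : ℝ) :
    ‖w + EuclideanSpace.single i h‖ ^ 2 = ‖w‖ ^ 2 + h ^ 2 + 2 * h * w i := by
  rw [norm_add_sq_real, EuclideanSpace.inner_single_right]
  simp
  ring

theorem rpow_neg_add_rpow_neg_ge {p A B : ℝ} (hp : 0 < p) (hA : 0 < A) (hB : |B| < A) :
    A ^ (-p) * (2 + p * (p + 1) * (B ^ 2 / A ^ 2)) ≤ (A + B) ^ (-p) + (A - B) ^ (-p) := by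
  have hx : |B / A| < 1 := by rwa [abs_div, abs_of_pos hA, div_lt_one hA]
  have h := two_add_sq_le_rpow_add_rpow_neg hp hx
  have h1 := abs_lt.mp hx
  have e1 : A + B = A * (1 + B / A) := by field_simp
  have e2 : A - B = A * (1 - B / A) := by field_simp
  rw [e1, e2, Real.mul_rpow hA.le (by linarith), Real.mul_rpow hA.le (by linarith), ← mul_add,
    ← div_pow]
  exact mul_le_mul_of_nonneg_left h (Real.rpow_nonneg hA.le _)

/-- The kernel is strictly subharmonic along the hyperplane, uniformly away from the origin. -/
theorem exists_forall_lt_sum_norm_rpow (hd : 3 ≤ d) (hs : (d : ℝ) - 3 < s) {δ : ℝ} (hδ : 0 < δ) :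
    ∃ h, 0 < h ∧ h < δ ∧ ∀ w ∈ hyperplane d, δ ≤ ‖w‖ →
      2 * ((d : ℝ) - 1) * ‖w‖ ^ (-s) < ∑ i ∈ directions d,
        (‖w + EuclideanSpace.single i h‖ ^ (-s) + ‖w + EuclideanSpace.single i (-h)‖ ^ (-s)) := by
  have hd' : (3 : ℝ) ≤ d := by exact_mod_cast hd
  set p := s / 2 with hp
  have hp0 : 0 < p := by rw [hp]; linarith
  obtain ⟨t₀, ht₀, ht⟩ := exists_forall_lt_rpow_mul (n := d - 1) hp0 (by rw [hp]; linarith)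
  -- With h = cδ, the bound 1/2 keeps h below ‖w‖, and both bounds give h²/‖w‖² ≤ c² < t₀, uniformly
  -- for ‖w‖ ≥ δ.
  set c := min (1 / 2) (t₀ / 2) with hc
  have hc0 : 0 < c := lt_min (by norm_num) (by linarith)
  have hc1 : c ≤ 1 / 2 := min_le_left _ _
  have hc2 : c ≤ t₀ / 2 := min_le_right _ _
  have hpow : ∀ v : EuclideanSpace ℝ (Fin d), ‖v‖ ^ (-s) = (‖v‖ ^ 2) ^ (-p) := by
    intro v
    rw [← Real.rpow_natCast, ← Real.rpow_mul (norm_nonneg v), hp]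
    congr 1
    push_cast; ring
  refine ⟨c * δ, by positivity, by nlinarith, fun w hw hwδ => ?_⟩
  set h := c * δ with hh
  have hh0 : 0 < h := by positivity
  set q := ‖w‖ ^ 2 with hq
  have hw0 : 0 < ‖w‖ := hδ.trans_le hwδ
  have hq0 : 0 < q := by positivity
  have hhw : h ≤ c * ‖w‖ := by rw [hh]; gcongr
  set t := h ^ 2 / q with htdef
  have ht0 : 0 < t := by positivity
  have htt : t < t₀ := by
    rw [htdef, div_lt_iff₀ hq0, hq]
    calc h ^ 2 ≤ (c * ‖w‖) ^ 2 := by gcongr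
      _ = c * c * ‖w‖ ^ 2 := by ring
      _ < t₀ * ‖w‖ ^ 2 := by
        have : c * c < t₀ := by nlinarith
        gcongr
  have hA : q + h ^ 2 = q * (1 + t) := by rw [htdef]; field_simp
  have hA0 : 0 < q + h ^ 2 := by positivity
  have hterm : ∀ i ∈ directions d,
      (q + h ^ 2) ^ (-p) * (2 + p * (p + 1) * ((2 * h * w i) ^ 2 / (q + h ^ 2) ^ 2)) ≤
      ‖w + EuclideanSpace.single i h‖ ^ (-s) + ‖w + EuclideanSpace.single i (-h)‖ ^ (-s) := by
    intro i _
    rw [hpow, hpow, norm_add_single_sq, norm_add_single_sq]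
    have hwi : |w i| ≤ ‖w‖ := by
      simpa using PiLp.norm_apply_le w i
    have hB : |2 * h * w i| < q + h ^ 2 := by
      rw [abs_mul, abs_of_pos (by positivity : 0 < 2 * h)]
      have : h < ‖w‖ := by nlinarith
      have h1 : 2 * h * |w i| ≤ 2 * h * ‖w‖ := by gcongr
      rw [hq]
      nlinarith [sq_nonneg (‖w‖ - h), mul_pos (sub_pos.mpr this) (sub_pos.mpr this)]
    have := rpow_neg_add_rpow_neg_ge hp0 hA0 hB
    rw [neg_sq, show ‖w‖ ^ 2 + h ^ 2 + 2 * -h * w i = q + h ^ 2 - 2 * h * w i by rw [hq]; ring]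
    exact this
  refine lt_of_lt_of_le ?_ (Finset.sum_le_sum hterm)
  -- Summing the squares `w i ^ 2` gives ‖w‖², so apart from the factor q^{-p} only t = h²/‖w‖²
  -- remains.
  have hsum : ∑ i ∈ directions d,
      (q + h ^ 2) ^ (-p) * (2 + p * (p + 1) * ((2 * h * w i) ^ 2 / (q + h ^ 2) ^ 2)) =
      q ^ (-p) * ((1 + t) ^ (-p) * (2 * ((d : ℝ) - 1) +
        4 * p * (p + 1) * (t / (1 + t) ^ 2))) := by
    have e1 : ∀ i, p * (p + 1) * ((2 * h * w i) ^ 2 / (q + h ^ 2) ^ 2) =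
        p * (p + 1) * (4 * h ^ 2 / (q + h ^ 2) ^ 2) * w i ^ 2 := fun i => by ring
    simp_rw [e1]
    rw [← Finset.mul_sum, Finset.sum_add_distrib, ← Finset.mul_sum, sum_directions_sq hw,
      Finset.sum_const, card_directions, nsmul_eq_mul, Nat.cast_sub (by lia), hA,
      Real.mul_rpow hq0.le (by linarith)]
    rw [← hq, mul_assoc]
    congr 2
    have : h ^ 2 = q * t := by rw [htdef]; field_simp
    rw [this]
    field_simp
    push_cast
    ring
  rw [hsum, hpow, ← hq, mul_comm]
  exact mul_lt_mul_of_pos_left (ht t ht0 htt) (Real.rpow_pos_of_pos hq0 _)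

/-! ### The maximum principle for upper semicontinuous potentials -/

theorem kernel_eq_ofReal {x y : EuclideanSpace ℝ (Fin d)} (h : x ≠ y) :
    1 / edist x y ^ s = ENNReal.ofReal (‖x - y‖ ^ (-s)) := by
  have h0 : 0 < ‖x - y‖ := norm_pos_iff.mpr (sub_ne_zero.mpr h)
  rw [edist_dist, dist_eq_norm, ENNReal.ofReal_rpow_of_pos h0, one_div,
    ← ENNReal.ofReal_inv_of_pos (Real.rpow_pos_of_pos h0 s), Real.rpow_neg h0.le]

theorem isClosed_hyperplane : IsClosed (hyperplane d) := by
  simp only [hyperplane, ofPred_forall]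
  refine isClosed_iInter fun i => isClosed_iInter fun _ => ?_
  exact isClosed_eq (by fun_prop) continuous_const

theorem add_single_mem_hyperplane {x : EuclideanSpace ℝ (Fin d)} (hx : x ∈ hyperplane d)
    {i : Fin d} (hi : i ∈ directions d) (h : ℝ) :
    x + EuclideanSpace.single i h ∈ hyperplane d := by
  intro j hj
  have hij : j ≠ i := by
    rintro rfl
    simp [directions, hj] at hi
  simp [hx j hj, hij]

theorem rieszPotential_le_of_forall_edist_ge (hs : 0 < s)
    {ν : Measure (EuclideanSpace ℝ (Fin d))} {K : Set (EuclideanSpace ℝ (Fin d))}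
    (hν : ν Kᶜ = 0) {x : EuclideanSpace ℝ (Fin d)} {r : ℝ≥0∞} (h : ∀ z ∈ K, r ≤ edist x z) :
    rieszPotential s ν x ≤ 1 / r ^ s * ν univ := by
  calc rieszPotential s ν x ≤ ∫⁻ _, 1 / r ^ s ∂ν := by
        refine lintegral_mono_ae ?_
        have : ∀ᵐ z ∂ν, z ∈ K := hν
        filter_upwards [this] with z hz
        gcongr
        exact h z hz
    _ = _ := lintegral_const _

/-- Finite differences replace the Laplacian, so nothing is differentiated under the integral. One h
serves all z in K, and strictness survives integration because ν ≠ 0 and the potential at x is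
finite. -/
theorem lt_sum_rieszPotential (hd : 3 ≤ d) (hs : (d : ℝ) - 3 < s)
    {ν : Measure (EuclideanSpace ℝ (Fin d))} [IsFiniteMeasure ν] (hν0 : ν ≠ 0)
    {K : Set (EuclideanSpace ℝ (Fin d))} (hKH : K ⊆ hyperplane d) (hν : ν Kᶜ = 0)
    {x : EuclideanSpace ℝ (Fin d)} (hx : x ∈ hyperplane d)
    {δ : ℝ} (hδ : 0 < δ) (hxK : ∀ z ∈ K, δ ≤ ‖x - z‖) :
    ∃ h : ℝ, 2 * ((d - 1 : ℕ) : ℝ≥0∞) * rieszPotential s ν x < ∑ i ∈ directions d,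
      (rieszPotential s ν (x + EuclideanSpace.single i h) +
        rieszPotential s ν (x + EuclideanSpace.single i (-h))) := by
  have hs0 : 0 < s := by
    have : (3 : ℝ) ≤ d := by exact_mod_cast hd
    linarith
  obtain ⟨h, hh0, hhδ, hlt⟩ := exists_forall_lt_sum_norm_rpow hd hs hδ
  have hνK : ∀ᵐ z ∂ν, z ∈ K := hν
  have hfin : rieszPotential s ν x ≠ ∞ := by
    refine ((rieszPotential_le_of_forall_edist_ge hs0 hν (r := ENNReal.ofReal δ)
      fun z hz => ?_).trans_lt (ENNReal.mul_lt_top ?_ (measure_lt_top ν _))).ne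
    · rw [edist_dist, dist_eq_norm]
      exact ENNReal.ofReal_le_ofReal (hxK z hz)
    · rw [ENNReal.ofReal_rpow_of_pos hδ, one_div]
      simpa using Real.rpow_pos_of_pos hδ s
  refine ⟨h, ?_⟩
  have hsum : ∑ i ∈ directions d, (rieszPotential s ν (x + EuclideanSpace.single i h) +
        rieszPotential s ν (x + EuclideanSpace.single i (-h))) =
      ∫⁻ z, ∑ i ∈ directions d, (1 / edist (x + EuclideanSpace.single i h) z ^ s +
        1 / edist (x + EuclideanSpace.single i (-h)) z ^ s) ∂ν := by
    rw [lintegral_finsetSum (f := fun i z => 1 / edist (x + EuclideanSpace.single i h) z ^ s +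
      1 / edist (x + EuclideanSpace.single i (-h)) z ^ s) _
      fun i _ => (measurable_kernel_right _).add (measurable_kernel_right _)]
    refine Finset.sum_congr rfl fun i _ => ?_
    rw [lintegral_add_left (measurable_kernel_right _)]
    rfl
  have hc : 2 * ((d - 1 : ℕ) : ℝ≥0∞) ≠ ∞ := ENNReal.mul_ne_top (by simp) (by simp)
  rw [hsum, rieszPotential, ← lintegral_const_mul' _ _ hc]
  refine lintegral_strict_mono hν0 ?_ ?_ ?_
  · exact (Finset.measurable_sum _ fun i _ =>
      (measurable_kernel_right _).add (measurable_kernel_right _)).aemeasurable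
  · rw [lintegral_const_mul' _ _ hc]
    exact ENNReal.mul_ne_top hc hfin
  filter_upwards [hνK] with z hz
  have hne : ∀ v : EuclideanSpace ℝ (Fin d), ‖v‖ < δ → x + v ≠ z := by
    rintro v hv rfl
    have := hxK _ hz
    simp at this
    linarith
  have hw := hlt (x - z) (fun j hj => by simp [hx j hj, hKH hz j hj]) (hxK z hz)
  have h1 : ∀ i : Fin d, 1 / edist (x + EuclideanSpace.single i h) z ^ s =
      ENNReal.ofReal (‖x - z + EuclideanSpace.single i h‖ ^ (-s)) := fun i => by
    rw [kernel_eq_ofReal (hne _ (by simpa [abs_of_pos hh0] using hhδ)), add_sub_right_comm]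
  have h2 : ∀ i : Fin d, 1 / edist (x + EuclideanSpace.single i (-h)) z ^ s =
      ENNReal.ofReal (‖x - z + EuclideanSpace.single i (-h)‖ ^ (-s)) := fun i => by
    rw [kernel_eq_ofReal (hne _ (by simpa [abs_of_pos hh0] using hhδ)), add_sub_right_comm]
  have hxz : x ≠ z := by simpa using hne 0 (by simpa using hδ)
  have hnn : ∀ v : EuclideanSpace ℝ (Fin d), 0 ≤ ‖v‖ ^ (-s) := fun v =>
    Real.rpow_nonneg (norm_nonneg v) _
  have h2d : 2 * ((d - 1 : ℕ) : ℝ≥0∞) = ENNReal.ofReal (2 * ((d : ℝ) - 1)) := by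
    rw [show (d : ℝ) - 1 = ((d - 1 : ℕ) : ℝ) by rw [Nat.cast_sub (by lia)]; simp,
      ENNReal.ofReal_mul (by norm_num), ENNReal.ofReal_natCast]
    simp
  have hd1 : (0 : ℝ) ≤ 2 * ((d : ℝ) - 1) := by
    have : (3 : ℝ) ≤ d := by exact_mod_cast hd
    linarith
  rw [kernel_eq_ofReal hxz, h2d, ← ENNReal.ofReal_mul hd1]
  simp_rw [h1, h2, ← ENNReal.ofReal_add (hnn _) (hnn _)]
  rw [← ENNReal.ofReal_sum_of_nonneg fun i _ => add_nonneg (hnn _) (hnn _),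
    ENNReal.ofReal_lt_ofReal_iff_of_nonneg (mul_nonneg hd1 (hnn _))]
  exact hw

/-- The maximum principle for potentials that are upper semicontinuous. -/
theorem rieszPotential_le_of_upperSemicontinuous (hd : 3 ≤ d) (hs : (d : ℝ) - 3 < s)
    {ν : Measure (EuclideanSpace ℝ (Fin d))} [IsFiniteMeasure ν]
    {K : Set (EuclideanSpace ℝ (Fin d))} (hK : IsCompact K) (hKH : K ⊆ hyperplane d)
    (hν : ν Kᶜ = 0) (husc : UpperSemicontinuous (rieszPotential s ν)) {M : ℝ≥0∞}
    (hM : ∀ x ∈ K, rieszPotential s ν x ≤ M) :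
    ∀ x ∈ hyperplane d, rieszPotential s ν x ≤ M := by
  have hs0 : 0 < s := by
    have : (3 : ℝ) ≤ d := by exact_mod_cast hd
    linarith
  intro x₁ hx₁
  by_contra hcon
  push Not at hcon
  set u := rieszPotential s ν with hu
  have hν0 : ν ≠ 0 := by
    rintro rfl
    simp [hu, rieszPotential] at hcon
  obtain ⟨ρ, hρ⟩ := hK.isBounded.subset_closedBall 0
  -- Decay at infinity confines the search for a maximum to a compact ball.
  have hdecay : ∃ R : ℝ, ∀ x, R ≤ ‖x‖ → u x < u x₁ := by
    have hlim : Tendsto (fun r : ℝ => 1 / (ENNReal.ofReal r) ^ s * ν univ) atTop (𝓝 0) := by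
      have h1 : Tendsto (fun r : ℝ => (ENNReal.ofReal r) ^ s) atTop (𝓝 ∞) :=
        (ENNReal.tendsto_rpow_at_top hs0).comp ENNReal.tendsto_ofReal_atTop
      have h2 := ENNReal.Tendsto.mul_const (b := ν univ) h1.inv
        (Or.inr (measure_ne_top ν _))
      simpa using h2
    have hpos : 0 < u x₁ := zero_le.trans_lt hcon
    obtain ⟨r, hr⟩ := (hlim.eventually (gt_mem_nhds hpos)).exists
    refine ⟨r + ρ, fun x hx => lt_of_le_of_lt
      (rieszPotential_le_of_forall_edist_ge hs0 hν fun z hz => ?_) hr⟩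
    rw [edist_dist, dist_eq_norm]
    refine ENNReal.ofReal_le_ofReal ?_
    have h1 : ‖z‖ ≤ ρ := by simpa using hρ hz
    have h2 := norm_sub_norm_le x z
    linarith
  obtain ⟨R, hR⟩ := hdecay
  have hx₁R : x₁ ∈ hyperplane d ∩ Metric.closedBall 0 R := by
    refine ⟨hx₁, ?_⟩
    by_contra h
    rw [mem_closedBall_zero_iff, not_le] at h
    exact (hR x₁ h.le).false
  obtain ⟨x₀, hx₀, hmax⟩ := (husc.upperSemicontinuousOn _).exists_isMaxOn ⟨x₁, hx₁R⟩
    ((isCompact_closedBall (0 : EuclideanSpace ℝ (Fin d)) R).inter_left isClosed_hyperplane)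
  have hglob : ∀ x ∈ hyperplane d, u x ≤ u x₀ := by
    intro x hx
    by_cases hxR : ‖x‖ ≤ R
    · exact hmax ⟨hx, by simpa using hxR⟩
    · exact (hR x (not_le.mp hxR).le).le.trans (hmax hx₁R)
  -- The maximum exceeds `M`, so it lies off `K`, where the strict sub-mean inequality rules it out.
  have hx₀K : x₀ ∉ K := fun h => not_le.mpr hcon ((hglob x₁ hx₁).trans (hM x₀ h))
  obtain ⟨δ, hδ, hδK⟩ : ∃ δ > 0, ∀ z ∈ K, δ ≤ ‖x₀ - z‖ := by
    obtain ⟨δ, hδ, hsub⟩ := Metric.mem_nhds_iff.mp (hK.isClosed.isOpen_compl.mem_nhds hx₀K)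
    refine ⟨δ, hδ, fun z hz => ?_⟩
    by_contra h
    refine hsub (a := z) ?_ hz
    rw [Metric.mem_ball, dist_comm, dist_eq_norm]
    exact not_le.mp h
  obtain ⟨h, hlt⟩ := lt_sum_rieszPotential hd hs hν0 hKH hν hx₀.1 hδ hδK
  refine absurd hlt (not_lt.mpr ?_)
  calc ∑ i ∈ directions d, (u (x₀ + EuclideanSpace.single i h) +
        u (x₀ + EuclideanSpace.single i (-h)))
      ≤ ∑ i ∈ directions d, (u x₀ + u x₀) := Finset.sum_le_sum fun i hi =>
        add_le_add (hglob _ (add_single_mem_hyperplane hx₀.1 hi h))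
          (hglob _ (add_single_mem_hyperplane hx₀.1 hi (-h)))
    _ = 2 * ((d - 1 : ℕ) : ℝ≥0∞) * u x₀ := by
        rw [Finset.sum_const, card_directions, nsmul_eq_mul]
        ring

/-! ### Kernel tails and the general maximum principle -/

/-- The part of the potential where the kernel exceeds `N`. -/
def potentialTail (s : ℝ) (N : ℝ≥0∞) (ν : Measure (EuclideanSpace ℝ (Fin d)))
    (x : EuclideanSpace ℝ (Fin d)) : ℝ≥0∞ :=
  ∫⁻ z, (1 / edist x z ^ s - N) ∂ν

theorem measurable_potentialTail (N : ℝ≥0∞) (ν : Measure (EuclideanSpace ℝ (Fin d))) [SFinite ν] :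
    Measurable (potentialTail s N ν) :=
  Measurable.lintegral_prod_right' (f := fun p => 1 / edist p.1 p.2 ^ s - N)
    (measurable_kernel.sub measurable_const)

theorem potentialTail_le (N : ℝ≥0∞) (ν : Measure (EuclideanSpace ℝ (Fin d)))
    (x : EuclideanSpace ℝ (Fin d)) : potentialTail s N ν x ≤ rieszPotential s ν x :=
  lintegral_mono fun _ => tsub_le_self

theorem tendsto_potentialTail {ν : Measure (EuclideanSpace ℝ (Fin d))}
    {x : EuclideanSpace ℝ (Fin d)} (hx : rieszPotential s ν x ≠ ∞) :
    Tendsto (fun N : ℕ => potentialTail s N ν x) atTop (𝓝 0) := by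
  have h0 : (0 : ℝ≥0∞) = ∫⁻ _, 0 ∂ν := by simp
  rw [h0]
  refine tendsto_lintegral_of_dominated_convergence (fun z => 1 / edist x z ^ s)
    (fun N => (measurable_kernel_right x).sub measurable_const)
    (fun N => Eventually.of_forall fun z => tsub_le_self) hx ?_
  filter_upwards [ae_lt_top (measurable_kernel_right x) hx] with z hz
  refine tendsto_const_nhds.congr' ?_
  obtain ⟨N₀, hN₀⟩ := ENNReal.exists_nat_gt hz.ne
  filter_upwards [eventually_ge_atTop N₀] with N hN
  rw [eq_comm, tsub_eq_zero_iff_le]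
  exact hN₀.le.trans (by exact_mod_cast hN)

/-- If y is a point of K nearest to x, then |y - z| ≤ 2|x - z| for z in K, so the kernel at x is at
most 2^s times the kernel at y. The threshold scales by the same factor. -/
theorem potentialTail_le_of_forall_mem (hs : 0 < s) {ν : Measure (EuclideanSpace ℝ (Fin d))}
    {K : Set (EuclideanSpace ℝ (Fin d))} (hK : IsCompact K) (hν : ν Kᶜ = 0) {N ε : ℝ≥0∞}
    (h : ∀ x ∈ K, potentialTail s N ν x ≤ ε) (x : EuclideanSpace ℝ (Fin d)) :
    potentialTail s (2 ^ s * N) ν x ≤ 2 ^ s * ε := by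
  have hνK : ∀ᵐ z ∂ν, z ∈ K := hν
  have h2 : (2 : ℝ≥0∞) ^ s ≠ ∞ := ENNReal.rpow_ne_top_of_nonneg hs.le (by simp)
  have h20 : (2 : ℝ≥0∞) ^ s ≠ 0 := by
    simp [ENNReal.rpow_eq_zero_iff]
  rcases K.eq_empty_or_nonempty with rfl | hne
  · have : ν = 0 := by simpa using hν
    simp [this, potentialTail]
  obtain ⟨y, hyK, hy⟩ := hK.exists_infEDist_eq_edist hne x
  refine le_trans ?_ (mul_le_mul_right (h y hyK) (2 ^ s))
  rw [potentialTail, potentialTail, ← lintegral_const_mul' _ _ h2]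
  refine lintegral_mono_ae ?_
  filter_upwards [hνK] with z hz
  rw [ENNReal.mul_sub (fun _ _ => h2)]
  refine tsub_le_tsub_right ?_ _
  have hd : edist y z ≤ 2 * edist x z := by
    calc edist y z ≤ edist x y + edist x z := edist_triangle_left y z x
      _ ≤ edist x z + edist x z := by
          gcongr
          rw [← hy]
          exact Metric.infEDist_le_edist_of_mem hz
      _ = 2 * edist x z := (two_mul _).symm
  have hd' : edist y z ^ s ≤ 2 ^ s * edist x z ^ s := by
    rw [← ENNReal.mul_rpow_of_nonneg _ _ hs.le]
    exact ENNReal.rpow_le_rpow hd hs.le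
  rw [one_div, one_div]
  calc (edist x z ^ s)⁻¹ = 2 ^ s * (2 ^ s * edist x z ^ s)⁻¹ := by
        rw [ENNReal.mul_inv (Or.inl h20) (Or.inl h2), ← mul_assoc, ENNReal.mul_inv_cancel h20 h2,
          one_mul]
    _ ≤ 2 ^ s * (edist y z ^ s)⁻¹ := by gcongr

theorem rieszPotential_eq_add_potentialTail (N : ℝ≥0∞) (ν : Measure (EuclideanSpace ℝ (Fin d)))
    (x : EuclideanSpace ℝ (Fin d)) :
    rieszPotential s ν x = (∫⁻ z, min (1 / edist x z ^ s) N ∂ν) + potentialTail s N ν x := by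
  rw [potentialTail, ← lintegral_add_left ((measurable_kernel_right x).min measurable_const)]
  refine lintegral_congr fun z => ?_
  rcases le_total (1 / edist x z ^ s) N with h | h
  · rw [min_eq_left h, tsub_eq_zero_of_le h, add_zero]
  · rw [min_eq_right h, add_tsub_cancel_of_le h]

theorem continuous_lintegral_min_kernel (N : ℕ) (ν : Measure (EuclideanSpace ℝ (Fin d)))
    [IsFiniteMeasure ν] :
    Continuous fun x => ∫⁻ z, min (1 / edist x z ^ s) N ∂ν := by
  refine continuous_iff_continuousAt.mpr fun x => ?_
  refine tendsto_lintegral_filter_of_dominated_convergence (fun _ => N)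
    (Eventually.of_forall fun y => (measurable_kernel_right y).min measurable_const)
    (Eventually.of_forall fun y => Eventually.of_forall fun z => min_le_right _ _) ?_
    (Eventually.of_forall fun z => ?_)
  · rw [lintegral_const]
    exact ENNReal.mul_ne_top (by simp) (measure_ne_top ν _)
  · exact (((continuous_kernel s).comp (Continuous.prodMk_left z)).min continuous_const).tendsto x

/-- Truncated potentials are continuous, and uniformly small tails make them uniform approximations.
-/
theorem upperSemicontinuous_rieszPotential_of_potentialTail
    {ν : Measure (EuclideanSpace ℝ (Fin d))} [IsFiniteMeasure ν]
    (h : ∀ ε : ℝ≥0∞, 0 < ε → ∃ N : ℕ, ∀ x, potentialTail s N ν x ≤ ε) :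
    UpperSemicontinuous (rieszPotential s ν) := by
  intro x y hy
  obtain ⟨r, hr, hlt⟩ := ENNReal.lt_iff_exists_add_pos_lt.mp hy
  obtain ⟨N, hN⟩ := h r (by exact_mod_cast hr)
  have hcont : Continuous fun x => (∫⁻ z, min (1 / edist x z ^ s) N ∂ν) + (r : ℝ≥0∞) :=
    (continuous_lintegral_min_kernel N ν).add continuous_const
  have hx : (∫⁻ z, min (1 / edist x z ^ s) N ∂ν) + (r : ℝ≥0∞) < y := by
    refine lt_of_le_of_lt ?_ hlt
    gcongr
    exact lintegral_mono fun z => min_le_left _ _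
  filter_upwards [(hcont.tendsto x).eventually (gt_mem_nhds hx)] with x' hx'
  refine lt_of_le_of_lt ?_ hx'
  rw [rieszPotential_eq_add_potentialTail N]
  gcongr
  exact hN x'

/-- A measure with potential finite on its support has, up to small mass, restrictions to compact
sets with upper semicontinuous potential. -/
theorem exists_isCompact_upperSemicontinuous (hs : 0 < s)
    {ν : Measure (EuclideanSpace ℝ (Fin d))} [IsFiniteMeasure ν]
    (hν : ∀ x ∈ ν.support, rieszPotential s ν x ≠ ∞) {η : ℝ} (hη : 0 < η) :
    ∃ K ⊆ ν.support, IsCompact K ∧ ν Kᶜ ≤ 2 * ENNReal.ofReal η ∧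
      UpperSemicontinuous (rieszPotential s (ν.restrict K)) := by
  have hsupp : ∀ᵐ x ∂ν, x ∈ ν.support := Measure.measure_compl_support
  -- Egorov's theorem: the tails tend to 0 uniformly off a set of mass at most η. Inner regularity
  -- costs another η below.
  obtain ⟨t, htm, htν, hunif⟩ := tendstoUniformlyOn_of_ae_tendsto' (μ := ν)
    (f := fun (N : ℕ) x => (potentialTail s N ν x).toReal) (g := fun _ => 0)
    (fun N => (measurable_potentialTail (N : ℝ≥0∞) ν).ennreal_toReal.stronglyMeasurable)
    stronglyMeasurable_const (by
      filter_upwards [hsupp] with x hx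
      have := (ENNReal.tendsto_toReal (by simp)).comp (tendsto_potentialTail (hν x hx))
      simpa [Function.comp_def] using this) hη
  have hAm : MeasurableSet (tᶜ ∩ ν.support) := htm.compl.inter Measure.isClosed_support.measurableSet
  obtain ⟨K, hKA, hK, hKlt⟩ := hAm.exists_isCompact_lt_add (measure_ne_top ν _)
    (ε := ENNReal.ofReal η) (by simpa using hη)
  have hKc : ν Kᶜ ≤ 2 * ENNReal.ofReal η := by
    have hsplit : Kᶜ ⊆ t ∪ ν.supportᶜ ∪ ((tᶜ ∩ ν.support) \ K) := by
      intro x hx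
      by_cases h1 : x ∈ t
      · exact Or.inl (Or.inl h1)
      by_cases h2 : x ∈ ν.support
      · exact Or.inr ⟨⟨h1, h2⟩, hx⟩
      · exact Or.inl (Or.inr h2)
    have hdiff : ν ((tᶜ ∩ ν.support) \ K) ≤ ENNReal.ofReal η := by
      rw [measure_sdiff hKA hK.measurableSet.nullMeasurableSet (measure_ne_top ν K)]
      exact tsub_le_iff_left.mpr hKlt.le
    calc ν Kᶜ ≤ ν (t ∪ ν.supportᶜ ∪ ((tᶜ ∩ ν.support) \ K)) := measure_mono hsplit
      _ ≤ ν t + ν ν.supportᶜ + ν ((tᶜ ∩ ν.support) \ K) :=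
          (measure_union_le _ _).trans (by gcongr; exact measure_union_le _ _)
      _ ≤ ENNReal.ofReal η + 0 + ENNReal.ofReal η := by
          gcongr
          exact Measure.measure_compl_support.le
      _ = 2 * ENNReal.ofReal η := by rw [add_zero, two_mul]
  refine ⟨K, hKA.trans inter_subset_right, hK, hKc, ?_⟩
  have hKν : ν.restrict K Kᶜ = 0 := by simp [Measure.restrict_apply hK.measurableSet.compl]
  have h2 : (2 : ℝ≥0∞) ^ s ≠ ∞ := ENNReal.rpow_ne_top_of_nonneg hs.le (by simp)
  have h20 : (2 : ℝ≥0∞) ^ s ≠ 0 := by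
    simp [ENNReal.rpow_eq_zero_iff]
  refine upperSemicontinuous_rieszPotential_of_potentialTail fun ε hε => ?_
  obtain ⟨e, he0, heε⟩ : ∃ e : ℝ, 0 < e ∧ 2 ^ s * ENNReal.ofReal e ≤ ε := by
    obtain ⟨e, he0, he⟩ := ENNReal.lt_iff_exists_nnreal_btwn.mp
      (ENNReal.div_pos hε.ne' h2)
    refine ⟨e, by exact_mod_cast he0, ?_⟩
    rw [ENNReal.ofReal_coe_nnreal]
    calc 2 ^ s * (e : ℝ≥0∞) ≤ 2 ^ s * (ε / 2 ^ s) := by gcongr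
      _ = ε := ENNReal.mul_div_cancel h20 h2
  obtain ⟨N, hN⟩ := (Metric.tendstoUniformlyOn_iff.mp hunif e he0).exists
  -- Leaving `K` multiplies the threshold by 2^s, so the bound at `N` on `K` serves every point at
  -- any larger level `N'` > 2^s N.
  obtain ⟨N', hN'⟩ := ENNReal.exists_nat_gt (ENNReal.mul_ne_top h2 (ENNReal.natCast_ne_top N))
  have htail : ∀ x ∈ K, potentialTail s N (ν.restrict K) x ≤ ENNReal.ofReal e := by
    intro x hx
    have h1 := hN x (hKA hx).1
    have hfin : potentialTail s N ν x ≠ ∞ :=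
      ((potentialTail_le _ _ _).trans_lt (hν x (hKA hx).2).lt_top).ne
    rw [dist_zero_left, Real.norm_of_nonneg ENNReal.toReal_nonneg] at h1
    calc potentialTail s N (ν.restrict K) x ≤ potentialTail s N ν x :=
          lintegral_mono' Measure.restrict_le_self fun _ => le_rfl
      _ ≤ ENNReal.ofReal e := ENNReal.le_ofReal_iff_toReal_le hfin he0.le |>.mpr h1.le
  refine ⟨N', fun x => ?_⟩
  calc potentialTail s N' (ν.restrict K) x ≤ potentialTail s (2 ^ s * N) (ν.restrict K) x :=
        lintegral_mono fun z => tsub_le_tsub_left hN'.le _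
    _ ≤ 2 ^ s * ENNReal.ofReal e := potentialTail_le_of_forall_mem hs hK hKν htail x
    _ ≤ ε := heε

/-- The maximum principle for Riesz potentials on the hyperplane. -/
theorem rieszPotential_le_of_le_on_support (hd : 3 ≤ d) (hs : (d : ℝ) - 3 < s)
    {ν : Measure (EuclideanSpace ℝ (Fin d))} [IsFiniteMeasure ν]
    (hνH : ν.support ⊆ hyperplane d) {M : ℝ≥0∞}
    (hM : ∀ x ∈ ν.support, rieszPotential s ν x ≤ M) :
    ∀ x ∈ hyperplane d, rieszPotential s ν x ≤ M := by
  have hs0 : 0 < s := by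
    have : (3 : ℝ) ≤ d := by exact_mod_cast hd
    linarith
  intro x hx
  rcases eq_or_ne M ∞ with rfl | hMtop
  · exact le_top
  -- With the kernel cut at `N`, discarding the part of ν off `K` costs at most 2Nη, which vanishes
  -- as η → 0.
  have htrunc : ∀ N : ℕ, ∫⁻ z, min (1 / edist x z ^ s) N ∂ν ≤ M := by
    intro N
    have hη : ∀ η : ℝ, 0 < η →
        ∫⁻ z, min (1 / edist x z ^ s) N ∂ν ≤ M + N * (2 * ENNReal.ofReal η) := by
      intro η hη
      obtain ⟨K, hKs, hK, hKc, husc⟩ := exists_isCompact_upperSemicontinuous (s := s) (ν := ν) hs0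
        (fun x hx => ((hM x hx).trans_lt hMtop.lt_top).ne) hη
      have hle : ∀ x, rieszPotential s (ν.restrict K) x ≤ rieszPotential s ν x := fun x =>
        lintegral_mono' Measure.restrict_le_self fun _ => le_rfl
      have hK' := rieszPotential_le_of_upperSemicontinuous hd hs hK (hKs.trans hνH)
        (by simp [Measure.restrict_apply hK.measurableSet.compl]) husc
        (fun x hx => (hle x).trans (hM x (hKs hx))) x hx
      rw [← lintegral_add_compl _ hK.measurableSet]
      gcongr
      · exact (lintegral_mono fun z => min_le_left _ _).trans hK'
      · calc ∫⁻ z in Kᶜ, min (1 / edist x z ^ s) N ∂ν ≤ ∫⁻ _ in Kᶜ, N ∂ν :=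
              lintegral_mono fun z => min_le_right _ _
          _ = N * ν Kᶜ := setLIntegral_const _ _
          _ ≤ _ := by gcongr
    have hlim : Tendsto (fun η : ℝ => M + N * (2 * ENNReal.ofReal η)) (𝓝[>] 0) (𝓝 M) := by
      have h1 : Tendsto (fun η : ℝ => ENNReal.ofReal η) (𝓝[>] 0) (𝓝 0) := by
        have := (ENNReal.continuous_ofReal.tendsto 0).mono_left (nhdsWithin_le_nhds (s := Ioi 0))
        simpa using this
      have h2 := ENNReal.Tendsto.const_mul (a := 2) h1 (Or.inr (by simp))
      have h3 := ENNReal.Tendsto.const_mul (a := (N : ℝ≥0∞)) h2 (Or.inr (by simp))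
      simpa using h3.const_add M
    exact ge_of_tendsto hlim (eventually_nhdsWithin_of_forall fun η h => hη η h)
  have hsup : rieszPotential s ν x = ⨆ N : ℕ, ∫⁻ z, min (1 / edist x z ^ s) N ∂ν := by
    rw [← lintegral_iSup]
    · refine lintegral_congr fun z => ?_
      rw [← inf_iSup_eq, ENNReal.iSup_natCast, inf_top_eq]
    · exact fun N => (measurable_kernel_right x).min measurable_const
    · exact fun N N' h z => min_le_min le_rfl (by exact_mod_cast h)
  rw [hsup]
  exact iSup_le htrunc

/-! ### The disk and the extended field -/

theorem isCompact_disk : IsCompact (disk d) := by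
  have : disk d = hyperplane d ∩ Metric.closedBall 0 1 := by
    ext x; simp [disk, hyperplane]
  rw [this]
  exact (isCompact_closedBall _ _).inter_left isClosed_hyperplane

theorem disk_subset_hyperplane : disk d ⊆ hyperplane d := fun _ hx => hx.1

open Classical in
/-- The extension of a field on the disk by `∞`. -/
def extendField (Q : EuclideanSpace ℝ (Fin d) → ℝ≥0∞) (x : EuclideanSpace ℝ (Fin d)) : ℝ≥0∞ :=
  if x ∈ disk d then Q x else ∞

/-- The complement of the disk is open, so the value `∞` there does no harm. The extension supplies
the global semicontinuity that `frostman` needs and leaves energies on the disk unchanged. -/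
theorem lowerSemicontinuous_extendField {Q : EuclideanSpace ℝ (Fin d) → ℝ≥0∞}
    (hQ : LowerSemicontinuousOn Q (disk d)) : LowerSemicontinuous (extendField Q) := by
  intro x y hy
  by_cases hx : x ∈ disk d
  · rw [extendField, if_pos hx] at hy
    filter_upwards [eventually_nhdsWithin_iff.mp (hQ x hx y hy)] with z hz
    by_cases h : z ∈ disk d
    · simpa [extendField, h] using hz h
    · simpa [extendField, h] using hy.trans_le le_top
  · have hyt : y < ∞ := hy.trans_le le_top
    filter_upwards [isCompact_disk.isClosed.isOpen_compl.mem_nhds hx] with z hz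
    simpa [extendField, show z ∉ disk d from hz] using hyt

theorem lintegral_extendField (Q : EuclideanSpace ℝ (Fin d) → ℝ≥0∞)
    {μ : Measure (EuclideanSpace ℝ (Fin d))} (hμ : μ ∈ unitMeasures (disk d)) :
    ∫⁻ x, extendField Q x ∂μ = ∫⁻ x, Q x ∂μ := by
  have : ∀ᵐ x ∂μ, x ∈ disk d := hμ.2
  refine lintegral_congr_ae ?_
  filter_upwards [this] with x hx
  simp [extendField, hx]

theorem weightedEnergy_extendField (Q : EuclideanSpace ℝ (Fin d) → ℝ≥0∞)
    {μ : Measure (EuclideanSpace ℝ (Fin d))} (hμ : μ ∈ unitMeasures (disk d)) :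
    weightedEnergy s (extendField Q) μ = weightedEnergy s Q μ := by
  rw [weightedEnergy, weightedEnergy, lintegral_extendField Q hμ]

/-! ### A measure of finite weighted energy -/

/-- In polar coordinates the integrand is r^{n-1-s}, integrable at 0 because s < n. -/
theorem lintegral_kernel_ball_lt_top {n : ℕ} (hn : 1 ≤ n) (hsn : s < n) :
    ∫⁻ y in Metric.ball (0 : EuclideanSpace ℝ (Fin n)) 1, 1 / ‖y‖ₑ ^ s < ∞ := by
  have : Nonempty (Fin n) := ⟨⟨0, hn⟩⟩
  have hint : IntegrableOn (fun x : EuclideanSpace ℝ (Fin n) => ‖x‖ ^ (-s))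
      (Metric.ball 0 1) volume := by
    rw [integrableOn_fun_norm_addHaar volume (f := fun r : ℝ => r ^ (-s))]
    rw [finrank_euclideanSpace_fin]
    have h1 : IntegrableOn (fun y : ℝ => y ^ ((n : ℝ) - 1 - s)) (Ioo 0 1) :=
      (intervalIntegral.integrableOn_Ioo_rpow_iff one_pos).mpr (by linarith)
    refine h1.congr_fun (fun y hy => ?_) measurableSet_Ioo
    simp only [smul_eq_mul]
    rw [← Real.rpow_natCast, ← Real.rpow_add hy.1, Nat.cast_sub hn]
    congr 1
    push_cast
    ring
  refine lt_of_le_of_lt (lintegral_mono_ae ?_) hint.hasFiniteIntegral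
  refine ae_restrict_of_ae ?_
  have h0 : ∀ᵐ y : EuclideanSpace ℝ (Fin n), y ≠ 0 := by
    simp [ae_iff]
  filter_upwards [h0] with y hy
  have hpos : 0 < ‖y‖ := norm_pos_iff.mpr hy
  rw [← ofReal_norm, ENNReal.ofReal_rpow_of_pos hpos, one_div,
    ← ENNReal.ofReal_inv_of_pos (Real.rpow_pos_of_pos hpos s), ← Real.rpow_neg hpos.le,
    ← ofReal_norm, Real.norm_of_nonneg (Real.rpow_nonneg hpos.le _)]

/-- Lebesgue measure on a set of finite measure has finite `s`-energy for `s < n`. -/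
theorem lintegral_lintegral_kernel_lt_top {n : ℕ} (hn : 1 ≤ n) (hs : 0 < s) (hsn : s < n)
    {B : Set (EuclideanSpace ℝ (Fin n))} (hB : volume B < ∞) :
    ∫⁻ x in B, ∫⁻ y in B, 1 / edist x y ^ s < ∞ := by
  set g : EuclideanSpace ℝ (Fin n) → ℝ≥0∞ :=
    (Metric.ball 0 1).indicator fun y => 1 / ‖y‖ₑ ^ s with hg
  have hgm : Measurable g := by
    refine Measurable.indicator ?_ measurableSet_ball
    fun_prop
  set C := (∫⁻ y in Metric.ball (0 : EuclideanSpace ℝ (Fin n)) 1, 1 / ‖y‖ₑ ^ s) + volume B with hC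
  have hCtop : C < ∞ := ENNReal.add_lt_top.mpr ⟨lintegral_kernel_ball_lt_top hn hsn, hB⟩
  -- Beyond distance 1 the kernel is at most 1; the near part is a translate of `g`, so the inner
  -- integrals are bounded uniformly in x.
  have hpt : ∀ x y : EuclideanSpace ℝ (Fin n), 1 / edist x y ^ s ≤ g (x - y) + 1 := by
    intro x y
    rw [edist_eq_enorm_sub]
    by_cases h : x - y ∈ Metric.ball (0 : EuclideanSpace ℝ (Fin n)) 1
    · rw [hg, indicator_of_mem h]
      exact le_self_add
    · refine le_add_left ?_
      rw [mem_ball_zero_iff, not_lt] at h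
      have h1 : (1 : ℝ≥0∞) ≤ ‖x - y‖ₑ := by
        rw [← ofReal_norm, ENNReal.one_le_ofReal]
        exact h
      have := ENNReal.one_le_rpow h1 hs
      rw [one_div]
      exact ENNReal.inv_le_one.mpr this
  have hin : ∀ x, ∫⁻ y in B, 1 / edist x y ^ s ≤ C := by
    intro x
    calc ∫⁻ y in B, 1 / edist x y ^ s ≤ ∫⁻ y in B, g (x - y) + 1 := lintegral_mono fun y => hpt x y
      _ = (∫⁻ y in B, g (x - y)) + volume B := by
          rw [lintegral_add_right _ measurable_const]
          simp
      _ ≤ (∫⁻ y, g (x - y)) + volume B := by gcongr; exact Measure.restrict_le_self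
      _ = C := by
          rw [lintegral_sub_left_eq_self g x, hg, lintegral_indicator measurableSet_ball]
  calc ∫⁻ x in B, ∫⁻ y in B, 1 / edist x y ^ s ≤ ∫⁻ _ in B, C := lintegral_mono hin
    _ = C * volume B := setLIntegral_const _ _
    _ < ∞ := ENNReal.mul_lt_top hCtop hB

/-- The inclusion of `ℝ^n` as the hyperplane of `ℝ^(n+1)`. -/
def hyperplaneEmbedding (n : ℕ) (x : EuclideanSpace ℝ (Fin n)) :
    EuclideanSpace ℝ (Fin (n + 1)) :=
  WithLp.toLp 2 (Fin.cons 0 x.ofLp)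

theorem isometry_hyperplaneEmbedding (n : ℕ) : Isometry (hyperplaneEmbedding n) := by
  refine Isometry.of_dist_eq fun x y => ?_
  simp [EuclideanSpace.dist_eq, Fin.sum_univ_succ, hyperplaneEmbedding]

theorem hyperplane_subset_range (n : ℕ) : hyperplane (n + 1) ⊆ range (hyperplaneEmbedding n) := by
  intro x hx
  refine ⟨WithLp.toLp 2 fun i => x i.succ, ?_⟩
  ext i
  refine Fin.cases ?_ (fun j => ?_) i
  · simp [hyperplaneEmbedding, hx 0 rfl]
  · simp [hyperplaneEmbedding]

/-- An external field admits a unit measure of finite weighted energy. -/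
theorem exists_weightedEnergy_lt_top (hd : 2 ≤ d) (hs : 0 < s) (hs₂ : s < (d : ℝ) - 1)
    {Q : EuclideanSpace ℝ (Fin d) → ℝ≥0∞} (hQ : IsExternalField d Q) :
    ∃ μ ∈ unitMeasures (disk d), weightedEnergy s (extendField Q) μ < ∞ := by
  obtain ⟨n, rfl⟩ : ∃ n, d = n + 1 := ⟨d - 1, by lia⟩
  have hpos := hQ.finite_on_pos
  rw [Nat.add_sub_cancel] at hpos
  have hlsc := lowerSemicontinuous_extendField hQ.lowerSemicontinuousOn
  have hι := isometry_hyperplaneEmbedding n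
  have hemb : MeasurableEmbedding (hyperplaneEmbedding n) := hι.isClosedEmbedding.measurableEmbedding
  set A : ℕ → Set (EuclideanSpace ℝ (Fin (n + 1))) := fun N => {x | extendField Q x ≤ N} with hA
  have hAdisk : ∀ N, A N ⊆ disk (n + 1) := by
    intro N x hx
    by_contra h
    simp [hA, extendField, h] at hx
  have hAc : ∀ N, IsClosed (A N) := fun N => hlsc.isClosed_preimage N
  have hunion : {x | x ∈ disk (n + 1) ∧ Q x < ∞} ⊆ ⋃ N, A N := by
    rintro x ⟨hx, hxQ⟩
    obtain ⟨N, hN⟩ := ENNReal.exists_nat_gt hxQ.ne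
    exact mem_iUnion.mpr ⟨N, by simpa [hA, extendField, hx] using hN.le⟩
  -- Countably many closed sublevel sets cover the finiteness set, so one has positive area; its
  -- normalised surface measure is the witness.
  obtain ⟨N, hN⟩ := exists_measure_pos_of_not_measure_iUnion_null
    (hpos.trans_le (measure_mono hunion)).ne'
  set B := hyperplaneEmbedding n ⁻¹' A N with hB
  have hBm : MeasurableSet B := hemb.measurable (hAc N).measurableSet
  have hB0 : volume B ≠ 0 := by
    rw [← EuclideanSpace.euclideanHausdorffMeasure_eq_volume, hB,
      hι.euclideanHausdorffMeasure_preimage, inter_eq_left.mpr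
        (((hAdisk N).trans disk_subset_hyperplane).trans (hyperplane_subset_range n))]
    exact hN.ne'
  have hBtop : volume B < ∞ := by
    have hcomp : IsCompact B :=
      hι.isClosedEmbedding.isCompact_preimage (isCompact_disk.of_isClosed_subset (hAc N) (hAdisk N))
    exact hcomp.measure_lt_top
  set c := (volume B)⁻¹ with hc
  have hctop : c ≠ ∞ := ENNReal.inv_ne_top.mpr hB0
  set ρ := c • volume.restrict B with hρ
  have hρA : ρ.map (hyperplaneEmbedding n) (A N)ᶜ = 0 := by
    rw [hemb.map_apply, preimage_compl, hρ, Measure.smul_apply, ← hB,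
      Measure.restrict_apply hBm.compl]
    simp
  refine ⟨ρ.map (hyperplaneEmbedding n), ⟨⟨?_⟩, ?_⟩, ?_⟩
  · rw [hemb.map_apply]
    simp [hρ, hc, ENNReal.inv_mul_cancel hB0 hBtop.ne]
  · exact measure_mono_null (compl_subset_compl.mpr (hAdisk N)) hρA
  rw [weightedEnergy, ENNReal.add_lt_top]
  constructor
  · rw [rieszEnergy_map hemb, hρ]
    simp only [hι.edist_eq, lintegral_smul_measure, smul_eq_mul]
    rw [lintegral_const_mul' _ _ hctop]
    have hsn : s < n := by push_cast at hs₂; linarith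
    exact ENNReal.mul_lt_top hctop.lt_top (ENNReal.mul_lt_top hctop.lt_top
      (lintegral_lintegral_kernel_lt_top (by lia) hs hsn hBtop))
  · refine ENNReal.mul_lt_top (by simp) ?_
    have hle : ∀ᵐ x ∂ρ.map (hyperplaneEmbedding n), extendField Q x ≤ N := hρA
    refine (lintegral_mono_ae hle).trans_lt ?_
    rw [lintegral_const, hemb.map_apply]
    simp [hρ, hc, ENNReal.inv_mul_cancel hB0 hBtop.ne]

/-! ### Equilibrium measures as minimisers for the zero field -/

theorem weightedEnergy_zero (μ : Measure (EuclideanSpace ℝ (Fin d))) :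
    weightedEnergy s (fun _ => 0) μ = rieszEnergy s μ := by
  simp [weightedEnergy]

theorem minEnergy_lt_top {E : Set (EuclideanSpace ℝ (Fin d))} (h : 0 < capacity s E) :
    minEnergy s E < ∞ := by
  rw [capacity, one_div, ENNReal.inv_pos] at h
  exact h.lt_top

/-- Existence suffices here: the later arguments use only that the chosen measure is a minimiser. -/
theorem isEquilibriumMeasure_equilibriumMeasure {E : Set (EuclideanSpace ℝ (Fin d))}
    (hE : IsCompact E) (hcap : 0 < capacity s E) :
    IsEquilibriumMeasure s E (equilibriumMeasure s E) := by
  have hex : ∃ μ, IsEquilibriumMeasure s E μ := by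
    have hne : (unitMeasures E).Nonempty := by
      by_contra h
      have := minEnergy_lt_top hcap
      simp [minEnergy, not_nonempty_iff_eq_empty.mp h] at this
    obtain ⟨μ, hμ, hmin⟩ := exists_forall_weightedEnergy_le (s := s) hE
      (lowerSemicontinuous_const (z := (0 : ℝ≥0∞))) hne
    simp only [weightedEnergy_zero] at hmin
    exact ⟨μ, hμ, le_antisymm (le_iInf₂ hmin) (iInf₂_le μ hμ)⟩
  rw [equilibriumMeasure, dif_pos hex]
  exact hex.choose_spec

theorem IsEquilibriumMeasure.weightedEnergy_le {E : Set (EuclideanSpace ℝ (Fin d))}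
    {ν : Measure (EuclideanSpace ℝ (Fin d))} (hν : IsEquilibriumMeasure s E ν) :
    ∀ ρ ∈ unitMeasures E, weightedEnergy s (fun _ => 0) ν ≤ weightedEnergy s (fun _ => 0) ρ := by
  simp only [weightedEnergy_zero, hν.2]
  exact fun ρ hρ => iInf₂_le ρ hρ

/-- The equilibrium potential is at most the minimal energy on the hyperplane. -/
theorem IsEquilibriumMeasure.rieszPotential_le (hd : 3 ≤ d) (hs : (d : ℝ) - 3 < s)
    {E : Set (EuclideanSpace ℝ (Fin d))} (hE : IsCompact E) (hEd : E ⊆ disk d)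
    (hfin : minEnergy s E < ∞) {ν : Measure (EuclideanSpace ℝ (Fin d))}
    (hν : IsEquilibriumMeasure s E ν) :
    ∀ x ∈ hyperplane d, rieszPotential s ν x ≤ minEnergy s E := by
  have := hν.1.1
  have hsupp : ν.support ⊆ E := Measure.support_subset_of_isClosed hE.isClosed hν.1.2
  refine rieszPotential_le_of_le_on_support hd hs
    ((hsupp.trans hEd).trans disk_subset_hyperplane) fun x hx => ?_
  have := frostman lowerSemicontinuous_const hν.1 (by rwa [weightedEnergy_zero, hν.2])
    hν.weightedEnergy_le x hx
  simpa [hν.2] using this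

theorem unitMeasures_mono {E F : Set (EuclideanSpace ℝ (Fin d))} (h : E ⊆ F) :
    unitMeasures E ⊆ unitMeasures F :=
  fun _ hμ => ⟨hμ.1, measure_mono_null (compl_subset_compl.mpr h) hμ.2⟩

end RieszDisk

end

/-! ### The Mhaskar–Saff functional -/

open RieszDisk in
theorem mainTheorem5 (d : ℕ) (hd : 3 ≤ d) (s : ℝ) (hs₁ : (d : ℝ) - 3 < s) (hs₂ : s < (d : ℝ) - 1)
    (Q : EuclideanSpace ℝ (Fin d) → ℝ≥0∞) (hQ : RieszDisk.IsExternalField d Q) :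
    RieszDisk.minWeightedEnergy s Q < ∞ ∧
    (∃ μQ, RieszDisk.IsExtremalMeasure s Q μQ) ∧
    ∀ μQ, RieszDisk.IsExtremalMeasure s Q μQ →
      (IsCompact μQ.support ∧ μQ.support ⊆ RieszDisk.disk d ∧
        0 < RieszDisk.capacity s μQ.support) ∧
      RieszDisk.mhaskarSaff s Q μQ.support = RieszDisk.extremalConstant s Q μQ ∧
      ∀ E : Set (EuclideanSpace ℝ (Fin d)), IsCompact E → E ⊆ RieszDisk.disk d →
        0 < RieszDisk.capacity s E →
        RieszDisk.mhaskarSaff s Q μQ.support ≤ RieszDisk.mhaskarSaff s Q E := by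
  have hs0 : 0 < s := by
    have : (3 : ℝ) ≤ d := by exact_mod_cast hd
    linarith
  have hlsc := lowerSemicontinuous_extendField hQ.lowerSemicontinuousOn
  obtain ⟨μ₀, hμ₀, hμ₀fin⟩ := exists_weightedEnergy_lt_top (by lia) hs0 hs₂ hQ
  have hV : minWeightedEnergy s Q < ∞ :=
    (iInf₂_le μ₀ hμ₀).trans_lt (weightedEnergy_extendField (s := s) Q hμ₀ ▸ hμ₀fin)
  refine ⟨hV, ?_, fun μ hμ => ?_⟩
  · obtain ⟨μ, hμ, hmin⟩ := exists_forall_weightedEnergy_le (s := s) isCompact_disk hlsc ⟨μ₀, hμ₀⟩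
    refine ⟨μ, hμ, le_antisymm (le_iInf₂ fun ν hν => ?_) (iInf₂_le μ hμ)⟩
    rw [← weightedEnergy_extendField Q hμ, ← weightedEnergy_extendField Q hν]
    exact hmin ν hν
  have := hμ.1.1
  have hmin : ∀ ρ ∈ unitMeasures (disk d),
      weightedEnergy s (extendField Q) μ ≤ weightedEnergy s (extendField Q) ρ := by
    intro ρ hρ
    rw [weightedEnergy_extendField Q hμ.1, weightedEnergy_extendField Q hρ, hμ.2]
    exact iInf₂_le ρ hρ
  have hfin : weightedEnergy s (extendField Q) μ < ∞ := by
    rwa [weightedEnergy_extendField Q hμ.1, hμ.2]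
  have hIfin : rieszEnergy s μ < ∞ := lt_of_le_of_lt le_self_add hfin
  have hqfin : ∫⁻ x, Q x ∂μ ≠ ∞ := by
    intro h
    rw [weightedEnergy, lintegral_extendField Q hμ.1, h] at hfin
    simp at hfin
  have hF : extremalConstant s Q μ = rieszEnergy s μ + ∫⁻ x, Q x ∂μ := by
    rw [extremalConstant, ← hμ.2, weightedEnergy, two_mul, ← add_assoc,
      ENNReal.add_sub_cancel_right hqfin]
  have hsupp : μ.support ⊆ disk d :=
    Measure.support_subset_of_isClosed isCompact_disk.isClosed hμ.1.2
  have hSc : IsCompact μ.support :=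
    isCompact_disk.of_isClosed_subset Measure.isClosed_support hsupp
  have hμS : μ ∈ unitMeasures μ.support := ⟨hμ.1.1, Measure.measure_compl_support⟩
  have hcap : 0 < capacity s μ.support := by
    rw [capacity, one_div, ENNReal.inv_pos]
    exact ((iInf₂_le μ hμS).trans_lt hIfin).ne
  have hlower : ∀ E : Set (EuclideanSpace ℝ (Fin d)), IsCompact E → E ⊆ disk d →
      0 < capacity s E → extremalConstant s Q μ ≤ mhaskarSaff s Q E := by
    intro E hE hEd hcapE
    have hν := isEquilibriumMeasure_equilibriumMeasure hE hcapE
    rw [mhaskarSaff]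
    set ν := equilibriumMeasure s E
    have := hν.1.1
    have hWfin := minEnergy_lt_top hcapE
    have hνd : ν ∈ unitMeasures (disk d) := unitMeasures_mono hEd hν.1
    -- Perturb μ towards the equilibrium measure of `E`, then swap the mutual energy so that the
    -- maximum principle applies.
    have hvar := add_le_of_forall_weightedEnergy_le hμ.1 hfin hmin hνd (hν.2 ▸ hWfin)
    rw [lintegral_extendField Q hμ.1, lintegral_extendField Q hνd,
      lintegral_rieszPotential_comm] at hvar
    rw [hF]
    refine hvar.trans ?_
    gcongr
    have hμd : ∀ᵐ x ∂μ, x ∈ disk d := hμ.1.2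
    calc ∫⁻ x, rieszPotential s ν x ∂μ ≤ ∫⁻ _, minEnergy s E ∂μ := by
          refine lintegral_mono_ae ?_
          filter_upwards [hμd] with x hx
          exact hν.rieszPotential_le hd hs₁ hE hEd hWfin x (disk_subset_hyperplane hx)
      _ = minEnergy s E := by simp
  have hupper : mhaskarSaff s Q μ.support ≤ extremalConstant s Q μ := by
    have hν := isEquilibriumMeasure_equilibriumMeasure hSc hcap
    rw [mhaskarSaff]
    set ν := equilibriumMeasure s μ.support
    have := hν.1.1
    have hWfin := minEnergy_lt_top hcap
    have hνd : ν ∈ unitMeasures (disk d) := unitMeasures_mono hsupp hν.1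
    -- Now the roles are reversed: the equilibrium measure of the support is perturbed towards μ,
    -- with zero field.
    have hvar := add_le_of_forall_weightedEnergy_le hν.1 (by rwa [weightedEnergy_zero, hν.2])
      hν.weightedEnergy_le hμS hIfin
    simp only [lintegral_zero, add_zero, hν.2] at hvar
    have hνS : ∀ᵐ x ∂ν, x ∈ μ.support := hν.1.2
    calc minEnergy s μ.support + ∫⁻ x, Q x ∂ν
        ≤ (∫⁻ x, rieszPotential s μ x ∂ν) + ∫⁻ x, extendField Q x ∂ν := by
          rw [lintegral_extendField Q hνd, lintegral_rieszPotential_comm μ ν]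
          gcongr
      _ = ∫⁻ x, rieszPotential s μ x + extendField Q x ∂ν :=
          (lintegral_add_left (measurable_rieszPotential μ) _).symm
      _ ≤ ∫⁻ _, extremalConstant s Q μ ∂ν := by
          refine lintegral_mono_ae ?_
          filter_upwards [hνS] with x hx
          rw [hF, ← lintegral_extendField Q hμ.1]
          exact frostman hlsc hμ.1 hfin hmin x hx
      _ = extremalConstant s Q μ := by simp
  have heq := le_antisymm hupper (hlower _ hSc hsupp hcap)
  exact ⟨⟨hSc, hsupp, hcap⟩, heq, fun E hE hEd hcapE => heq ▸ hlower E hE hEd hcapE⟩
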